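/- For every $\varepsilon>0$ there is a constant $K=K(\varepsilon)>0$ such that the following holds for every function $p=p(n)\in[0,1]$ satisfying $p\ge K\log n/n$ for all sufficiently large $n$. Let $G(n,p)$ be the binomial random graph on the vertex set $[n]$, in which every pair of vertices is an edge independently with probability $p$. With probability tending to $1$ as $n\to\infty$, the random graph $G\sim G(n,p)$ is such that for every subgraph $H\subseteq G$ with maximum degree $\Delta(H)\le(1-\varepsilon)np/6$, the graph $G-H$ obtained from $G$ by deleting the edges of $H$ is Hamiltonian (contains a cycle through all vertices), and $$r_\ell(G,\mathcal{H})\ \ge\ (1-\varepsilon)\,\frac{np}{6}.$$ Here $\mathcal{H}$ is the property of being Hamiltonian, and $r_\ell(G,\mathcal P)$, the local resilience of $G=(V,E)$ with respect to a graph property $\mathcal P$, is the minimum of $\Delta(H)$ over all graphs $H=(V,F)$ for which $(V,E\triangle F)$ does not have the property $\mathcal P$. -/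

import Mathlib

open Filter Topology
open scoped ENNReal

/-- The local resilience of a graph `G` on a finite vertex set with respect to a graph property `P`:
the least maximum degree of a graph `H` on the same vertex set such that changing `G` along the
edges of `H` (taking the symmetric difference of the edge sets) gives a graph without `P`.
It is `⊤` if there is no such `H`, that is, if every graph on the vertex set has `P`. -/
noncomputable def localResilience {V : Type*} [Fintype V] (G : SimpleGraph V)
    (P : SimpleGraph V → Prop) : ℕ∞ :=
  open scoped Classical in
  ⨅ (H : SimpleGraph V) (_ : ¬ P (symmDiff G H)), (H.maxDegree : ℕ∞)

/-!
The proof combines Pósa's rotation technique with a union bound over sparse subgraphs. All random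
edge sets are handled through the weights `binomialWeight E q S`, whose generating function
`sum_binomialWeight_mul_pow` gives the exponential tail bounds.

With high probability `G` has about the expected number of edges in every cut between a nonempty set
`U` and the complement of a set `X ⊇ U` with `|X| ≤ 3 |U|` and `|X| ≤ (1 - ε / 4) n`
(`binomialRandom_real_cut_lower_tail`; the union over `(U, X)` costs only `exp (O(|U| log n))`,
which a large `K` absorbs). A graph `H` of maximum degree at most `(1 - ε) n p / 6` cannot remove
such a cut, since the larger side has at least `n / 6` vertices. Sampling the edges of `G \ H` at a
small constant rate therefore leaves a graph `F₀` with few edges, in which every set of at most about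
`n / 3` vertices has twice as many outside neighbours (`exists_sparse_isDoubleExpander`).

If a graph `F ⊇ F₀` is not Hamiltonian, rotations of a longest path yield a set `A` of more than `k`
endpoints, where `k` is about `n / 3`, and for every `a ∈ A` more than `k` vertices `b` such that
adding `ab` closes a longest path to a cycle. As `F` is connected, adding `ab` makes the graph
Hamiltonian or its longest path longer (`IsDoubleExpander.exists_isBoosterSet`). Every such booster
is counted at most twice, so there are at least about `|A| n / 6` of them. With high probability,
simultaneously for all sparse `F ≤ G`, about a proportion `p` of the boosters of `F` are edges of `G`
(`binomialRandom_real_sparse_subgraph`): the boosters are determined by `F` and disjoint from it, and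
there are few sparse `F`. This is more than the `|A| (1 - ε) n p / 6` boosters that `H` can contain,
which is where the constant `1 / 6` comes from. So `G \ H` contains a booster of `F`, and after at
most `n` boosters the graph is Hamiltonian (`isHamiltonian_sdiff_of_pseudorandom`).
-/

/-! ### Binomial random subsets of a finite set -/

section BinomialWeight

variable {α : Type*} [DecidableEq α]

/-- The probability that the random subset of `E`, to which every element belongs independently
with probability `q`, equals `S`. -/
noncomputable def binomialWeight (E : Finset α) (q : ℝ) (S : Finset α) : ℝ :=
  q ^ S.card * (1 - q) ^ (E \ S).card

lemma binomialWeight_nonneg {q : ℝ} (h0 : 0 ≤ q) (h1 : q ≤ 1) (E S : Finset α) :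
    0 ≤ binomialWeight E q S :=
  mul_nonneg (pow_nonneg h0 _) (pow_nonneg (sub_nonneg.2 h1) _)

/-- The generating function of `|S ∩ P|`, restricted to the event `F ⊆ S`. -/
lemma sum_binomialWeight_mul_pow {E F P : Finset α} (hF : F ⊆ E) (hP : P ⊆ E)
    (hFP : Disjoint F P) (q y : ℝ) :
    ∑ S ∈ E.powerset with F ⊆ S, binomialWeight E q S * y ^ (S ∩ P).card =
      q ^ F.card * (1 - q + q * y) ^ P.card := by
  have h := Finset.prod_add (fun i => q * if i ∈ P then y else 1)
    (fun i => if i ∈ F then 0 else 1 - q) E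
  have hleft : ∏ i ∈ E, ((q * if i ∈ P then y else 1) + if i ∈ F then 0 else 1 - q) =
      q ^ F.card * (1 - q + q * y) ^ P.card := by
    have : ∀ i ∈ E, ((q * if i ∈ P then y else 1) + if i ∈ F then 0 else 1 - q) =
        (if i ∈ F then q else 1) * (if i ∈ P then 1 - q + q * y else 1) := by
      intro i _
      by_cases h1 : i ∈ F
      · have h2 : i ∉ P := Finset.disjoint_left.1 hFP h1
        simp [h1, h2]
      · by_cases h2 : i ∈ P
        · simp [h1, h2]; ring
        · simp [h1, h2]
    rw [Finset.prod_congr rfl this, Finset.prod_mul_distrib, Finset.prod_ite_mem,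
      Finset.prod_ite_mem, Finset.inter_eq_right.2 hF, Finset.inter_eq_right.2 hP]
    simp
  rw [← hleft, h, Finset.sum_filter]
  refine Finset.sum_congr rfl fun S hS => ?_
  rw [Finset.prod_mul_distrib, Finset.prod_const, Finset.prod_ite_mem, Finset.prod_const]
  split_ifs with hFS
  · have : ∏ i ∈ E \ S, (if i ∈ F then 0 else 1 - q) = (1 - q) ^ (E \ S).card := by
      rw [← Finset.prod_const]
      refine Finset.prod_congr rfl fun i hi => if_neg fun hiF => ?_
      exact (Finset.mem_sdiff.1 hi).2 (hFS hiF)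
    rw [this, binomialWeight]; ring
  · obtain ⟨i, hiF, hiS⟩ := Finset.not_subset.1 hFS
    rw [Finset.prod_eq_zero (i := i) (Finset.mem_sdiff.2 ⟨hF hiF, hiS⟩) (by simp [hiF]), mul_zero]

lemma sum_binomialWeight (E : Finset α) (q : ℝ) :
    ∑ S ∈ E.powerset, binomialWeight E q S = 1 := by
  simpa using sum_binomialWeight_mul_pow (Finset.empty_subset E) (Finset.empty_subset E)
    (Finset.disjoint_empty_left _) q 1

/-- Chernoff's bound for the lower tail of `|S ∩ P|`, on the event `F ⊆ S`. -/
lemma sum_binomialWeight_lower_tail {E F P : Finset α} (hF : F ⊆ E) (hP : P ⊆ E)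
    (hFP : Disjoint F P) {q η : ℝ} (h0 : 0 ≤ q) (h1 : q ≤ 1) (hη : 0 ≤ η) :
    ∑ S ∈ E.powerset with F ⊆ S ∧ ((S ∩ P).card : ℝ) < (1 - η) * q * P.card,
        binomialWeight E q S ≤
      q ^ F.card * Real.exp (-(η ^ 2 * q * P.card / 4)) := by
  set s : ℝ := η / 2 with hs
  set μ : ℝ := q * P.card with hμ
  have hμ0 : 0 ≤ μ := by positivity
  calc _ ≤ ∑ S ∈ E.powerset with F ⊆ S ∧ ((S ∩ P).card : ℝ) < (1 - η) * q * P.card,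
        Real.exp (s * (1 - η) * μ) * (binomialWeight E q S * Real.exp (-s) ^ (S ∩ P).card) := by
        refine Finset.sum_le_sum fun S hS => ?_
        have hlt := (Finset.mem_filter.1 hS).2.2
        have hge : 1 ≤ Real.exp (s * (1 - η) * μ) * Real.exp (-s) ^ (S ∩ P).card := by
          rw [← Real.exp_nat_mul, ← Real.exp_add]
          apply Real.one_le_exp
          have : s * ((S ∩ P).card : ℝ) ≤ s * ((1 - η) * q * P.card) :=
            mul_le_mul_of_nonneg_left hlt.le (by positivity)
          rw [hμ]; linarith
        calc binomialWeight E q S = binomialWeight E q S * 1 := (mul_one _).symm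
          _ ≤ binomialWeight E q S * (Real.exp (s * (1 - η) * μ) *
              Real.exp (-s) ^ (S ∩ P).card) :=
            mul_le_mul_of_nonneg_left hge (binomialWeight_nonneg h0 h1 _ _)
          _ = _ := by ring
    _ ≤ ∑ S ∈ E.powerset with F ⊆ S,
        Real.exp (s * (1 - η) * μ) * (binomialWeight E q S * Real.exp (-s) ^ (S ∩ P).card) := by
        refine Finset.sum_le_sum_of_subset_of_nonneg ?_ fun S _ _ => ?_
        · intro S hS
          rw [Finset.mem_filter] at hS ⊢
          exact ⟨hS.1, hS.2.1⟩
        · have := binomialWeight_nonneg h0 h1 E S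
          positivity
    _ = Real.exp (s * (1 - η) * μ) * (q ^ F.card * (1 - q + q * Real.exp (-s)) ^ P.card) := by
        rw [← Finset.mul_sum, sum_binomialWeight_mul_pow hF hP hFP]
    _ ≤ Real.exp (s * (1 - η) * μ) * (q ^ F.card * Real.exp (q * (-s + s ^ 2)) ^ P.card) := by
        have he : Real.exp (-s) ≤ 1 - s + s ^ 2 := by
          have h2 : s + 1 ≤ Real.exp s := Real.add_one_le_exp s
          have h3 : 0 < s + 1 := by positivity
          rw [Real.exp_neg]
          calc (Real.exp s)⁻¹ ≤ (s + 1)⁻¹ := inv_anti₀ h3 h2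
            _ ≤ 1 - s + s ^ 2 := by
              rw [inv_le_iff_one_le_mul₀ h3]
              have : 0 ≤ s ^ 3 := by positivity
              nlinarith
        have hb : 1 - q + q * Real.exp (-s) ≤ Real.exp (q * (-s + s ^ 2)) := by
          have := Real.add_one_le_exp (q * (-s + s ^ 2))
          nlinarith
        have hb0 : 0 ≤ 1 - q + q * Real.exp (-s) := by
          have := Real.exp_pos (-s)
          have : 0 ≤ q * Real.exp (-s) := by positivity
          linarith
        gcongr
    _ = q ^ F.card * Real.exp (-(η ^ 2 * q * P.card / 4)) := by
        rw [← Real.exp_nat_mul, mul_left_comm, ← Real.exp_add]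
        congr 2
        rw [hμ, hs]; ring

/-- An exponential bound for the upper tail of the size of a binomial random set. -/
lemma sum_binomialWeight_upper_tail (E : Finset α) {q : ℝ} (h0 : 0 ≤ q) (h1 : q ≤ 1) (a : ℝ) :
    ∑ S ∈ E.powerset with a ≤ (S.card : ℝ), binomialWeight E q S ≤
      Real.exp (2 * q * E.card - a) := by
  calc _ ≤ ∑ S ∈ E.powerset with a ≤ (S.card : ℝ),
        Real.exp (-a) * (binomialWeight E q S * Real.exp 1 ^ (S ∩ E).card) := by
        refine Finset.sum_le_sum fun S hS => ?_
        obtain ⟨hSE, hlt⟩ := Finset.mem_filter.1 hS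
        rw [Finset.inter_eq_left.2 (Finset.mem_powerset.1 hSE)]
        have hge : 1 ≤ Real.exp (-a) * Real.exp 1 ^ S.card := by
          rw [← Real.exp_nat_mul, ← Real.exp_add]
          apply Real.one_le_exp
          linarith
        calc binomialWeight E q S = binomialWeight E q S * 1 := (mul_one _).symm
          _ ≤ binomialWeight E q S * (Real.exp (-a) * Real.exp 1 ^ S.card) :=
            mul_le_mul_of_nonneg_left hge (binomialWeight_nonneg h0 h1 _ _)
          _ = _ := by ring
    _ ≤ ∑ S ∈ E.powerset with ∅ ⊆ S,
        Real.exp (-a) * (binomialWeight E q S * Real.exp 1 ^ (S ∩ E).card) := by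
        refine Finset.sum_le_sum_of_subset_of_nonneg ?_ fun S _ _ => ?_
        · intro S hS
          rw [Finset.mem_filter] at hS ⊢
          exact ⟨hS.1, Finset.empty_subset S⟩
        · have := binomialWeight_nonneg h0 h1 E S
          positivity
    _ = Real.exp (-a) * (1 - q + q * Real.exp 1) ^ E.card := by
        rw [← Finset.mul_sum, sum_binomialWeight_mul_pow (Finset.empty_subset E) subset_rfl
          (Finset.disjoint_empty_left _)]
        simp
    _ ≤ Real.exp (-a) * Real.exp (2 * q) ^ E.card := by
        have he := Real.exp_one_lt_three
        have he' := Real.exp_pos 1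
        have hb : 1 - q + q * Real.exp 1 ≤ Real.exp (2 * q) := by
          have := Real.add_one_le_exp (2 * q)
          nlinarith
        have hb0 : 0 ≤ 1 - q + q * Real.exp 1 := by
          have : 0 ≤ q * Real.exp 1 := by positivity
          linarith
        gcongr
    _ = Real.exp (2 * q * E.card - a) := by
        rw [← Real.exp_nat_mul, ← Real.exp_add]
        congr 1; ring

lemma sum_binomialWeight_disjoint_le {E P : Finset α} (hP : P ⊆ E) {q : ℝ} (h1 : q ≤ 1) :
    ∑ S ∈ E.powerset with S ∩ P = ∅, binomialWeight E q S ≤ Real.exp (-(q * P.card)) := by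
  have h := sum_binomialWeight_mul_pow (Finset.empty_subset E) hP
    (Finset.disjoint_empty_left _) q 0
  have h2 : ∑ S ∈ E.powerset with S ∩ P = ∅, binomialWeight E q S = (1 - q) ^ P.card := by
    simp only [Finset.empty_subset, Finset.filter_true, Finset.card_empty, pow_zero, one_mul,
      mul_zero, add_zero] at h
    rw [← h, Finset.sum_filter]
    refine Finset.sum_congr rfl fun S _ => ?_
    by_cases hS : S ∩ P = ∅
    · simp [hS]
    · simp [hS, zero_pow]
  rw [h2]
  calc (1 - q) ^ P.card ≤ Real.exp (-q) ^ P.card := by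
        have := Real.add_one_le_exp (-q)
        exact pow_le_pow_left₀ (by linarith) (by linarith) _
    _ = _ := by rw [← Real.exp_nat_mul]; congr 1; ring

/-- A sampling lemma: `E` has a subset with fewer than `a` elements that meets every `P i`, as soon
as the failure probabilities of a binomial random subset sum to less than `1`. -/
lemma exists_subset_card_lt_forall_inter_nonempty {ι : Type*} (T : Finset ι) (P : ι → Finset α)
    {E : Finset α} (hP : ∀ i ∈ T, P i ⊆ E) {q a : ℝ} (h0 : 0 ≤ q) (h1 : q ≤ 1)
    (hlt : Real.exp (2 * q * E.card - a) + ∑ i ∈ T, Real.exp (-(q * (P i).card)) < 1) :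
    ∃ S ⊆ E, (S.card : ℝ) < a ∧ ∀ i ∈ T, (S ∩ P i).Nonempty := by
  by_contra! hcon
  refine absurd hlt (not_lt.2 ?_)
  rw [← sum_binomialWeight E q]
  calc ∑ S ∈ E.powerset, binomialWeight E q S
      ≤ ∑ S ∈ E.powerset, ((if a ≤ (S.card : ℝ) then binomialWeight E q S else 0) +
          ∑ i ∈ T, if S ∩ P i = ∅ then binomialWeight E q S else 0) := by
        refine Finset.sum_le_sum fun S hS => ?_
        have hw := binomialWeight_nonneg h0 h1 E S
        have hnn : ∀ i ∈ T, 0 ≤ if S ∩ P i = ∅ then binomialWeight E q S else 0 := by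
          intro i _; split_ifs <;> simp [hw]
        by_cases ha : a ≤ (S.card : ℝ)
        · rw [if_pos ha]
          exact le_add_of_nonneg_right (Finset.sum_nonneg hnn)
        · rw [if_neg ha, zero_add]
          obtain ⟨i, hi, hiS⟩ := hcon S (Finset.mem_powerset.1 hS) (not_le.1 ha)
          calc binomialWeight E q S = if S ∩ P i = ∅ then binomialWeight E q S else 0 := by
                rw [if_pos hiS]
            _ ≤ _ := Finset.single_le_sum hnn hi
    _ = ∑ S ∈ E.powerset with a ≤ (S.card : ℝ), binomialWeight E q S +
          ∑ i ∈ T, ∑ S ∈ E.powerset with S ∩ P i = ∅, binomialWeight E q S := by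
        rw [Finset.sum_add_distrib, Finset.sum_comm (s := E.powerset)]
        simp only [Finset.sum_filter]
    _ ≤ _ := add_le_add (sum_binomialWeight_upper_tail E h0 h1 a)
        (Finset.sum_le_sum fun i hi => sum_binomialWeight_disjoint_le (hP i hi) h1)

/-- A union bound over all sets `F` with at most `m` elements: the probability that the random set
contains some such `F` but only few elements of the test set `Ψ F`, disjoint from `F`. The factor
`exp (L * m)` and the damping `exp (-L)` of the generating function of `|F|` come from
`1 ≤ exp (L * (m - |F|))`. -/
lemma sum_sum_binomialWeight_lower_tail {E : Finset α} (Ψ : Finset α → Finset α)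
    (T : Finset (Finset α)) {q η m a L : ℝ} (h0 : 0 ≤ q) (h1 : q ≤ 1) (hη : 0 ≤ η) (hL : 0 ≤ L)
    (hT : ∀ F ∈ T, F ⊆ E ∧ Ψ F ⊆ E ∧ Disjoint F (Ψ F) ∧ (F.card : ℝ) ≤ m ∧
      a ≤ ((Ψ F).card : ℝ)) :
    ∑ F ∈ T, ∑ S ∈ E.powerset with F ⊆ S ∧ ((S ∩ Ψ F).card : ℝ) < (1 - η) * q * (Ψ F).card,
        binomialWeight E q S ≤
      Real.exp (L * m + q * Real.exp (-L) * E.card - η ^ 2 * q * a / 4) := by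
  calc _ ≤ ∑ F ∈ T, Real.exp (L * m - η ^ 2 * q * a / 4) *
        ((q * Real.exp (-L)) ^ F.card * 1 ^ (E.card - F.card)) := by
        refine Finset.sum_le_sum fun F hF => ?_
        obtain ⟨hFE, hΨE, hd, hm, ha⟩ := hT F hF
        refine (sum_binomialWeight_lower_tail hFE hΨE hd h0 h1 hη).trans ?_
        rw [one_pow, mul_one, mul_pow, mul_left_comm, ← Real.exp_nat_mul, ← Real.exp_add]
        gcongr
        have h2 : L * F.card ≤ L * m := mul_le_mul_of_nonneg_left hm hL
        have h3 : η ^ 2 * q * a ≤ η ^ 2 * q * (Ψ F).card :=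
          mul_le_mul_of_nonneg_left ha (by positivity)
        linarith
    _ ≤ ∑ F ∈ E.powerset, Real.exp (L * m - η ^ 2 * q * a / 4) *
        ((q * Real.exp (-L)) ^ F.card * 1 ^ (E.card - F.card)) := by
        refine Finset.sum_le_sum_of_subset_of_nonneg ?_ fun S _ _ => by positivity
        exact fun F hF => Finset.mem_powerset.2 (hT F hF).1
    _ = Real.exp (L * m - η ^ 2 * q * a / 4) * (q * Real.exp (-L) + 1) ^ E.card := by
        rw [← Finset.mul_sum, Finset.sum_pow_mul_eq_add_pow]
    _ ≤ Real.exp (L * m - η ^ 2 * q * a / 4) * Real.exp (q * Real.exp (-L)) ^ E.card := by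
        gcongr
        exact Real.add_one_le_exp _
    _ = _ := by
        rw [← Real.exp_nat_mul, ← Real.exp_add]
        congr 1; ring

end BinomialWeight

/-- The union bound over all pairs `(U, X)` with `U` nonempty and `|X| ≤ 3|U|`, each pair costing
`y ^ (4 |U|) ≤ y ^ |U| * y ^ |X|`. -/
lemma sum_pow_card_le {V : Type*} [Fintype V] [DecidableEq V] {y : ℝ} (h0 : 0 ≤ y) (h1 : y ≤ 1)
    (T : Finset (Finset V × Finset V)) (hT : ∀ t ∈ T, t.1.Nonempty ∧ t.2.card ≤ 3 * t.1.card) :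
    ∑ t ∈ T, y ^ (4 * t.1.card) ≤
      ((1 + y) ^ Fintype.card V - 1) * (1 + y) ^ Fintype.card V := by
  have hsum : ∑ X : Finset V, y ^ X.card = (1 + y) ^ Fintype.card V := by
    have := Finset.sum_pow_mul_eq_add_pow y 1 (Finset.univ : Finset V)
    rw [add_comm]
    simpa using this
  calc ∑ t ∈ T, y ^ (4 * t.1.card) ≤ ∑ t ∈ T, y ^ t.1.card * y ^ t.2.card := by
        refine Finset.sum_le_sum fun t ht => ?_
        rw [← pow_add]
        exact pow_le_pow_of_le_one h0 h1 (by have := (hT t ht).2; omega)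
    _ ≤ ∑ t ∈ (Finset.univ.erase ∅ : Finset (Finset V)) ×ˢ
          (Finset.univ : Finset (Finset V)), y ^ t.1.card * y ^ t.2.card := by
        refine Finset.sum_le_sum_of_subset_of_nonneg (fun t ht => ?_) fun _ _ _ => by positivity
        simpa using (hT t ht).1.ne_empty
    _ = _ := by
        rw [Finset.sum_product]
        simp only
        rw [← Finset.sum_mul_sum, hsum]
        congr 1
        rw [← hsum, ← Finset.add_sum_erase _ _ (Finset.mem_univ (∅ : Finset V))]
        simp

/-! ### Rotations of longest paths -/

namespace SimpleGraph

variable {V : Type*} {F F' : SimpleGraph V}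

/-- A list of vertices is a path of `F`: its entries are distinct and consecutive ones adjacent. -/
def IsPathList (F : SimpleGraph V) (l : List V) : Prop :=
  l.IsChain F.Adj ∧ l.Nodup

/-- A path of `F` such that no path of `F` has more vertices. -/
def IsLongestPathList (F : SimpleGraph V) (l : List V) : Prop :=
  F.IsPathList l ∧ ∀ l', F.IsPathList l' → l'.length ≤ l.length

/-- The lists obtained from `l` by Pósa rotations that keep the last vertex fixed: if the head of
`s ++ x :: b` is adjacent to `x`, then the initial segment `s` may be reversed. -/
inductive Rotation (F : SimpleGraph V) (l : List V) : List V → Prop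
  | refl : Rotation F l l
  | step (s b : List V) (e x : V) : Rotation F l (s ++ x :: b) → s.head? = some e → F.Adj e x →
      Rotation F l (s.reverse ++ x :: b)

lemma IsPathList.mono (h : F ≤ F') {l : List V} (hl : F.IsPathList l) : F'.IsPathList l :=
  ⟨hl.1.imp fun _ _ hab => h hab, hl.2⟩

lemma IsPathList.reverse {l : List V} (hl : F.IsPathList l) : F.IsPathList l.reverse :=
  ⟨List.isChain_reverse.2 (hl.1.imp fun _ _ h => h.symm), List.nodup_reverse.2 hl.2⟩

lemma IsLongestPathList.reverse {l : List V} (hl : F.IsLongestPathList l) :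
    F.IsLongestPathList l.reverse :=
  ⟨hl.1.reverse, fun l' h => by simpa using hl.2 l' h⟩

lemma Rotation.perm {l l' : List V} (h : F.Rotation l l') : l'.Perm l := by
  induction h with
  | refl => exact List.Perm.refl _
  | step s b e x _ _ _ ih => exact (s.reverse_perm.append_right _).trans ih

lemma Rotation.isPathList {l l' : List V} (h : F.Rotation l l') (hl : F.IsPathList l) :
    F.IsPathList l' := by
  induction h with
  | refl => exact hl
  | step s b e x _ he hadj ih =>
    refine ⟨?_, ((s.reverse_perm.append_right _).nodup_iff).2 ih.2⟩
    have h1 := List.isChain_append.1 ih.1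
    refine List.isChain_append.2 ⟨List.isChain_reverse.2 (h1.1.imp fun _ _ h => h.symm), h1.2.1, ?_⟩
    intro y hy z hz
    rw [List.getLast?_reverse, he] at hy
    simp only [List.head?_cons, Option.mem_def, Option.some.injEq] at hy hz
    subst hy hz
    exact hadj

lemma Rotation.isLongestPathList {l l' : List V} (h : F.Rotation l l')
    (hl : F.IsLongestPathList l) : F.IsLongestPathList l' :=
  ⟨h.isPathList hl.1, fun m hm => (hl.2 m hm).trans_eq h.perm.length_eq.symm⟩

lemma Rotation.getLast? {l l' : List V} (h : F.Rotation l l') : l'.getLast? = l.getLast? := by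
  induction h with
  | refl => rfl
  | step s b e x _ _ _ ih =>
    rw [← ih, List.getLast?_append, List.getLast?_append]
    simp [List.getLast?_cons]

/-- Pósa's rotation lemma: a neighbour `w` of an endpoint `v` of a rotated longest path is itself
such an endpoint, or it is next to such an endpoint on the original path. If it were neither, no
rotation would ever touch the path edges at `w`; but then rotating along `vw` would make one of the
original path neighbours of `w` an endpoint. -/
lemma exists_consecutive_of_adj_endpoint {l : List V} (hl : F.IsLongestPathList l) {l' : List V}
    {v w : V} (hrot : F.Rotation l l') (hv : l'.head? = some v) (hadj : F.Adj v w)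
    (hw : ∀ m, F.Rotation l m → m.head? ≠ some w) :
    ∃ t, (∃ m, F.Rotation l m ∧ m.head? = some t) ∧ ([w, t] <:+: l ∨ [t, w] <:+: l) := by
  by_contra! hcon
  let N : V → Prop := fun t => [w, t] <:+: l ∨ [t, w] <:+: l
  have hN : ∀ t, N t → ∀ m, F.Rotation l m → m.head? ≠ some t := by
    intro t ht m hm hmt
    have := hcon t ⟨m, hm, hmt⟩
    rcases ht with h | h
    · exact this.1 h
    · exact this.2 h
  let R : V → V → Prop := fun p q => (p = w → N q) ∧ (q = w → N p)
  have hinv : ∀ m, F.Rotation l m → m.IsChain R := by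
    intro m hm
    induction hm with
    | refl =>
      refine List.isChain_iff_forall_rel_of_append_cons_cons.2 fun p q s t hst => ⟨?_, ?_⟩
      · rintro rfl
        exact Or.inl ⟨s, t, by simp [hst]⟩
      · rintro rfl
        exact Or.inr ⟨s, t, by simp [hst]⟩
    | step s b e x hm he hex ih =>
      have h1 := List.isChain_append.1 ih
      refine List.isChain_append.2 ⟨List.isChain_reverse.2 (h1.1.imp fun _ _ h => ⟨h.2, h.1⟩),
        h1.2.1, ?_⟩
      intro y hy z hz
      rw [List.getLast?_reverse, he] at hy
      simp only [List.head?_cons, Option.mem_def, Option.some.injEq] at hy hz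
      subst hy hz
      have hne : s ≠ [] := by rintro rfl; simp at he
      refine ⟨fun h => ?_, fun h => ?_⟩
      · subst h
        refine absurd ?_ (hw _ hm)
        simp [List.head?_append, he]
      · subst h
        have hlast : s.getLast? = some (s.getLast hne) := List.getLast?_eq_getLast_of_ne_nil hne
        have := (h1.2.2 _ hlast x (by simp)).2 rfl
        refine absurd ?_ (hN _ this _ (Rotation.step s b e x hm he hex))
        simp [List.head?_append, hlast]
  have hwl : w ∈ l' := by
    by_contra hwl
    have hlong := (hrot.isLongestPathList hl)
    have := hlong.2 (w :: l') ⟨List.isChain_cons.2 ⟨fun y hy => ?_, hlong.1.1⟩,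
      List.nodup_cons.2 ⟨hwl, hlong.1.2⟩⟩
    · simp at this
    · rw [hv] at hy
      simp only [Option.mem_def, Option.some.injEq] at hy
      subst hy
      exact hadj.symm
  obtain ⟨s, b, rfl⟩ := List.append_of_mem hwl
  have hne : s ≠ [] := by
    rintro rfl
    simp only [List.nil_append, List.head?_cons, Option.some.injEq] at hv
    exact hadj.ne hv.symm
  have hlast : s.getLast? = some (s.getLast hne) := List.getLast?_eq_getLast_of_ne_nil hne
  have hsv : s.head? = some v := by
    cases s with
    | nil => exact absurd rfl hne
    | cons c s => simpa using hv
  have := ((List.isChain_append.1 (hinv _ hrot)).2.2 _ hlast w (by simp)).2 rfl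
  refine absurd ?_ (hN _ this _ (Rotation.step s b v w hrot hsv hadj))
  simp [List.head?_append, hlast]

/-- Every nonempty set `U` of at most `k` vertices has at least `2 |U|` neighbours outside `U`:
equivalently, an edge leads from `U` out of every `X ⊇ U` with fewer than `3 |U|` vertices. -/
def IsDoubleExpander (F : SimpleGraph V) (k : ℕ) : Prop :=
  ∀ U X : Finset V, U.Nonempty → U.card ≤ k → U ⊆ X → X.card < 3 * U.card →
    ∃ u ∈ U, ∃ w ∉ X, F.Adj u w

lemma IsDoubleExpander.mono {k : ℕ} (h : F ≤ F') (hF : F.IsDoubleExpander k) :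
    F'.IsDoubleExpander k := by
  intro U X h1 h2 h3 h4
  obtain ⟨u, hu, w, hw, huw⟩ := hF U X h1 h2 h3 h4
  exact ⟨u, hu, w, hw, h huw⟩

lemma _root_.List.Nodup.eq_of_infix_left {l : List V} (hl : l.Nodup) {v y z : V}
    (hy : [v, y] <:+: l) (hz : [v, z] <:+: l) : y = z := by
  obtain ⟨s, t, rfl⟩ := hy
  obtain ⟨s', t', h⟩ := hz
  simp only [List.append_assoc, List.cons_append, List.nil_append] at h hl
  have hnd := List.nodup_append.1 (h ▸ hl)
  have := (List.append_cons_inj_of_notMem (fun hv => hnd.2.2 v hv v (by simp) rfl)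
    (fun hv => (List.nodup_cons.1 hnd.2.1).1 hv)).1 h
  simp only [List.cons.injEq, true_and] at this
  exact this.2.1.symm

lemma _root_.List.Nodup.eq_of_infix_right {l : List V} (hl : l.Nodup) {v y z : V}
    (hy : [y, v] <:+: l) (hz : [z, v] <:+: l) : y = z := by
  have h : ∀ {u}, [u, v] <:+: l → [v, u] <:+: l.reverse := fun {u} hu => by
    simpa using List.reverse_infix.2 hu
  exact (List.nodup_reverse.2 hl).eq_of_infix_left (h hy) (h hz)

/-- In a double expander, the rotations of a longest path have more than `k` endpoints: otherwise
the endpoints together with their neighbours on the path would contradict the expansion, since the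
head of the path has only one neighbour on it. -/
lemma IsLongestPathList.lt_card_endpoints [Fintype V] {k : ℕ} (hF : F.IsDoubleExpander k)
    {l : List V} (hl : F.IsLongestPathList l) (hne : l ≠ []) (S : Finset V)
    (hS : ∀ v, v ∈ S ↔ ∃ m, F.Rotation l m ∧ m.head? = some v) : k < S.card := by
  classical
  by_contra! hk
  obtain ⟨v, b, rfl⟩ := List.exists_cons_of_ne_nil hne
  have hvS : v ∈ S := (hS v).2 ⟨_, Rotation.refl, rfl⟩
  let A : V → Finset V := fun t => Finset.univ.filter fun w => [t, w] <:+: v :: b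
  let B : V → Finset V := fun t => Finset.univ.filter fun w => [w, t] <:+: v :: b
  have hA : (S.biUnion A).card ≤ S.card * 1 := Finset.card_biUnion_le_card_mul _ _ _ fun t _ =>
    Finset.card_le_one.2 fun y hy z hz =>
      hl.1.2.eq_of_infix_left (Finset.mem_filter.1 hy).2 (Finset.mem_filter.1 hz).2
  have hB : ((S.erase v).biUnion B).card ≤ (S.erase v).card * 1 :=
    Finset.card_biUnion_le_card_mul _ _ _ fun t _ =>
      Finset.card_le_one.2 fun y hy z hz =>
        hl.1.2.eq_of_infix_right (Finset.mem_filter.1 hy).2 (Finset.mem_filter.1 hz).2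
  have hpos : 0 < S.card := Finset.card_pos.2 ⟨v, hvS⟩
  obtain ⟨u, hu, w, hw, huw⟩ := hF S (S ∪ (S.biUnion A ∪ (S.erase v).biUnion B)) ⟨v, hvS⟩ hk
    Finset.subset_union_left (by
      have h1 := Finset.card_union_le S (S.biUnion A ∪ (S.erase v).biUnion B)
      have h2 := Finset.card_union_le (S.biUnion A) ((S.erase v).biUnion B)
      have h3 := Finset.card_erase_of_mem hvS
      omega)
  simp only [Finset.mem_union, not_or] at hw
  obtain ⟨m, hm, hmu⟩ := (hS u).1 hu
  obtain ⟨t, ht, h⟩ := exists_consecutive_of_adj_endpoint hl hm hmu huw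
    fun m hm hmw => hw.1 ((hS w).2 ⟨m, hm, hmw⟩)
  have htS := (hS t).2 ht
  rcases h with h | h
  · refine hw.2.2 (Finset.mem_biUnion.2 ⟨t, Finset.mem_erase.2 ⟨?_, htS⟩, by simpa [B] using h⟩)
    rintro rfl
    obtain ⟨s, c, hsc⟩ := h
    have hnd := hl.1.2
    cases s with
    | nil =>
      simp only [List.nil_append, List.cons_append, List.cons.injEq] at hsc
      obtain ⟨rfl, rfl⟩ := hsc
      simp at hnd
    | cons d s =>
      simp only [List.cons_append, List.cons.injEq] at hsc
      obtain ⟨rfl, rfl⟩ := hsc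
      simp at hnd
  · exact hw.2.1 (Finset.mem_biUnion.2 ⟨t, htS, by simpa [A] using h⟩)

/-- A double expander with `n < 6k` vertices is connected: of two complementary sets of vertices
without edges between them, both would have more than `k` vertices, and one fewer than `3k`. -/
lemma IsDoubleExpander.exists_adj_of_ne_univ [Fintype V] {k : ℕ}
    (hF : F.IsDoubleExpander k) (hk : Fintype.card V < 6 * k) {C : Finset V} (hC : C.Nonempty)
    (hC' : C ≠ Finset.univ) : ∃ x ∈ C, ∃ y ∉ C, F.Adj x y := by
  classical
  have key : ∀ D : Finset V, D.Nonempty → D.card < 3 * k → ∃ x ∈ D, ∃ y ∉ D, F.Adj x y := by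
    intro D hD hcard
    rcases le_total D.card k with h | h
    · have := hD.card_pos
      exact hF D D hD h subset_rfl (by omega)
    · obtain ⟨U, hUD, hU⟩ := Finset.exists_subset_card_eq h
      obtain ⟨x, hx, h⟩ := hF U D (Finset.card_pos.1 (by omega)) hU.le hUD (by omega)
      exact ⟨x, hUD hx, h⟩
  have hsum := Finset.card_add_card_compl C
  rcases lt_or_ge C.card (3 * k) with h | h
  · exact key C hC h
  · obtain ⟨x, hx, y, hy, hxy⟩ := key Cᶜ (Finset.nonempty_iff_ne_empty.2
      fun h => hC' ((Finset.compl_eq_empty_iff C).1 h)) (by omega)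
    exact ⟨y, by simpa using hy, x, by simpa using hx, hxy.symm⟩

/-! ### Boosters -/

lemma isHamiltonian_of_closed_pathList [Fintype V] [DecidableEq V] {l : List V}
    (hl : F.IsPathList l) (hall : ∀ v, v ∈ l) (h3 : 3 ≤ l.length) {a b : V}
    (ha : l.head? = some a) (hb : l.getLast? = some b) (hab : F.Adj b a) : F.IsHamiltonian := by
  intro _
  have hne : l ≠ [] := by rintro rfl; simp at h3
  have ha' : l.head hne = a := by simpa [List.head?_eq_some_head hne] using ha
  have hb' : l.getLast hne = b := by simpa [List.getLast?_eq_getLast_of_ne_nil hne] using hb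
  let p := Walk.ofSupport l hne hl.1
  have hps : p.support = l := Walk.support_ofSupport hne hl.1
  have hpath : p.IsPath := Walk.IsPath.mk' (hps.symm ▸ hl.2)
  have hlen : p.length + 1 = l.length := by rw [← Walk.length_support, hps]
  have hadj : F.Adj (l.getLast hne) (l.head hne) := by rw [ha', hb']; exact hab
  refine ⟨_, Walk.cons hadj p, ?_⟩
  rw [Walk.isHamiltonianCycle_iff_isCycle_and_support_count_tail_eq_one]
  refine ⟨(Walk.cons_isCycle_iff _ _).2 ⟨hpath, fun hmem => ?_⟩, fun v => ?_⟩
  · have := hpath.length_eq_one_of_mem_edges (by rwa [Sym2.eq_swap])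
    omega
  · rw [Walk.support_cons, List.tail_cons, hps]
    exact List.count_eq_one_of_mem hl.2 (hall v)

/-- If the ends of a path are adjacent in a connected graph, then the graph is Hamiltonian or has
a longer path: a vertex off the cycle can be attached to it, and the cycle cut open there. -/
lemma isHamiltonian_or_exists_longer_pathList [Fintype V] [DecidableEq V] {l : List V}
    (hl : F.IsPathList l) (h3 : 3 ≤ l.length)
    (hconn : ∀ C : Finset V, C.Nonempty → C ≠ Finset.univ → ∃ x ∈ C, ∃ y ∉ C, F.Adj x y) {a b : V}
    (ha : l.head? = some a) (hb : l.getLast? = some b) (hab : F.Adj b a) :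
    F.IsHamiltonian ∨ ∃ l', F.IsPathList l' ∧ l.length < l'.length := by
  by_cases hall : ∀ v, v ∈ l
  · exact Or.inl (isHamiltonian_of_closed_pathList hl hall h3 ha hb hab)
  right
  push Not at hall
  obtain ⟨z, hz⟩ := hall
  obtain ⟨x, hx, y, hy, hxy⟩ := hconn l.toFinset ⟨a, by
      simpa using List.mem_of_mem_head? ha⟩ (fun h => hz (by
      rw [← List.mem_toFinset, h]; exact Finset.mem_univ z))
  rw [List.mem_toFinset] at hx hy
  obtain ⟨s, t, rfl⟩ := List.append_of_mem hx
  have h1 := List.isChain_append.1 hl.1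
  refine ⟨y :: (x :: t ++ s), ⟨List.isChain_cons.2 ⟨?_, List.isChain_append.2
    ⟨h1.2.1, h1.1, ?_⟩⟩, List.nodup_cons.2 ⟨?_, ?_⟩⟩, ?_⟩
  · simp [hxy.symm]
  · intro p hp q hq
    have hpb : p = b := by
      rw [List.getLast?_append] at hb
      simp only [Option.mem_def] at hp
      rw [hp] at hb
      simpa using hb
    have hqa : q = a := by
      simp only [Option.mem_def] at hq
      rw [List.head?_append, hq] at ha
      simpa using ha
    rw [hpb, hqa]; exact hab
  · intro hmem
    apply hy
    simp only [List.cons_append, List.mem_cons, List.mem_append] at hmem ⊢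
    tauto
  · exact List.perm_append_comm.nodup_iff.1 hl.2
  · simp; omega

/-- A set `P` of boosters for `F`, all of them meeting the vertex set `A`: adding any pair from `P`
to `F` makes `F` Hamiltonian or creates a path longer than all paths of `F`. -/
structure IsBoosterSet [Fintype V] [DecidableEq V] (F : SimpleGraph V) (k : ℕ) (A : Finset V)
    (P : Finset (Sym2 V)) : Prop where
  lt_card : k < A.card
  card_mul_le : A.card * (k + 1) ≤ 2 * P.card
  not_isDiag : ∀ e ∈ P, ¬ e.IsDiag
  notMem_edgeSet : ∀ e ∈ P, e ∉ F.edgeSet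
  exists_mem : ∀ e ∈ P, ∃ a ∈ A, a ∈ e
  boost : ∀ e ∈ P, ∀ F' : SimpleGraph V, F ≤ F' → e ∈ F'.edgeSet → F'.IsHamiltonian ∨
    ∃ l', F'.IsPathList l' ∧ ∀ l, F.IsPathList l → l.length < l'.length

lemma exists_isLongestPathList [Fintype V] (F : SimpleGraph V) : ∃ l, F.IsLongestPathList l := by
  have hbdd : BddAbove {m | ∃ l, F.IsPathList l ∧ l.length = m} :=
    ⟨Fintype.card V, by rintro _ ⟨l, hl, rfl⟩; exact hl.2.length_le_card⟩
  obtain ⟨l, hl, hlen⟩ := Nat.sSup_mem (s := {m | ∃ l, F.IsPathList l ∧ l.length = m})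
    ⟨0, [], ⟨List.isChain_nil, List.nodup_nil⟩, rfl⟩ hbdd
  exact ⟨l, hl, fun l' hl' => hlen ▸ le_csSup hbdd ⟨l', hl', rfl⟩⟩

/-- A non-Hamiltonian double expander has many boosters. The set `A` consists of the endpoints of
the rotations of a longest path, and for every `a ∈ A` the boosters at `a` lead to the endpoints of
the rotations that fix `a`. -/
theorem IsDoubleExpander.exists_isBoosterSet [Fintype V] [Nonempty V] [DecidableEq V] {k : ℕ}
    (hF : F.IsDoubleExpander k) (hk : Fintype.card V < 6 * k) (h2 : 2 ≤ k)
    (hham : ¬ F.IsHamiltonian) : ∃ A P, F.IsBoosterSet k A P := by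
  classical
  have hconn : ∀ {F'}, F ≤ F' → ∀ C : Finset V, C.Nonempty → C ≠ Finset.univ →
      ∃ x ∈ C, ∃ y ∉ C, F'.Adj x y := fun hle C h1 h2 =>
    (hF.mono hle).exists_adj_of_ne_univ hk h1 h2
  obtain ⟨l, hl⟩ := F.exists_isLongestPathList
  let ends : List V → Finset V := fun l =>
    Finset.univ.filter fun v => ∃ m, F.Rotation l m ∧ m.head? = some v
  have hends : ∀ l v, v ∈ ends l ↔ ∃ m, F.Rotation l m ∧ m.head? = some v := fun l v => by
    simp [ends]
  have hlne : l ≠ [] := by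
    rintro rfl
    have := hl.2 [Classical.arbitrary V] ⟨List.isChain_singleton _, List.nodup_singleton _⟩
    simp at this
  have hA : k < (ends l).card := hl.lt_card_endpoints hF hlne _ (hends l)
  have h3 : 3 ≤ l.length := by
    have hsub : ends l ⊆ l.toFinset := by
      intro v hv
      obtain ⟨m, hm, hmv⟩ := (hends l v).1 hv
      exact List.mem_toFinset.2 (hm.perm.mem_iff.1 (List.mem_of_mem_head? hmv))
    have := (Finset.card_le_card hsub).trans (List.toFinset_card_le l)
    omega
  -- for every endpoint `a`, a longest path with last vertex `a`
  have hpath : ∀ a, ∃ m, a ∈ ends l → F.IsLongestPathList m ∧ m.getLast? = some a := by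
    intro a
    by_cases ha : a ∈ ends l
    · obtain ⟨m, hm, hma⟩ := (hends l a).1 ha
      exact ⟨m.reverse, fun _ => ⟨(hm.isLongestPathList hl).reverse, by simpa using hma⟩⟩
    · exact ⟨[], fun h => absurd h ha⟩
  choose m hm using hpath
  have hboost : ∀ a ∈ ends l, ∀ b ∈ ends (m a), ∀ F', F ≤ F' → F'.Adj a b → F'.IsHamiltonian ∨
      ∃ l', F'.IsPathList l' ∧ ∀ l, F.IsPathList l → l.length < l'.length := by
    intro a ha b hb F' hle hab
    obtain ⟨c, hc, hcb⟩ := (hends _ b).1 hb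
    obtain ⟨hma, hlast⟩ := hm a ha
    have hcl := hc.isLongestPathList hma
    have hlen : l.length ≤ c.length := hcl.2 l hl.1
    rcases isHamiltonian_or_exists_longer_pathList (hcl.1.mono hle) (h3.trans hlen) (hconn hle)
      hcb (hc.getLast?.trans hlast) hab with h | ⟨l', hl', hlt⟩
    · exact Or.inl h
    · exact Or.inr ⟨l', hl', fun d hd => (hcl.2 d hd).trans_lt hlt⟩
  have hne : ∀ a ∈ ends l, ∀ b ∈ ends (m a), a ≠ b := by
    rintro a ha b hb rfl
    obtain ⟨c, hc, hcb⟩ := (hends _ a).1 hb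
    obtain ⟨hma, hlast⟩ := hm a ha
    have hcl := hc.isLongestPathList hma
    have hlen : l.length ≤ c.length := hcl.2 l hl.1
    have hlast' := hc.getLast?.trans hlast
    have hnd := hcl.1.2
    match c, hcb, hlast', hnd with
    | [], h, _, _ => simp at h
    | [x], _, _, _ => simp at hlen; omega
    | x :: y :: t, h1, h2, h3 =>
      simp only [List.head?_cons, Option.some.injEq] at h1
      rw [List.getLast?_cons_cons] at h2
      exact (List.nodup_cons.1 h3).1 (h1 ▸ List.mem_of_getLast? h2)
  let Q : Finset (Σ _ : V, V) := (ends l).sigma fun a => ends (m a)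
  have hQ : ∀ t : Σ _ : V, V, t ∈ Q ↔ t.1 ∈ ends l ∧ t.2 ∈ ends (m t.1) := fun t => Finset.mem_sigma
  refine ⟨ends l, Q.image fun t => s(t.1, t.2), hA, ?_, ?_, ?_, ?_, ?_⟩
  · calc (ends l).card * (k + 1) ≤ Q.card := by
          rw [Finset.card_sigma]
          rw [← smul_eq_mul]
          refine Finset.card_nsmul_le_sum _ _ _ fun a ha => ?_
          obtain ⟨hma, hlast⟩ := hm a ha
          exact hma.lt_card_endpoints hF (by rintro h; simp [h] at hlast) _ (hends _)
      _ ≤ 2 * (Q.image fun t => s(t.1, t.2)).card := by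
          refine Finset.card_le_mul_card_image _ _ fun e _ => ?_
          induction e with | h x y =>
          refine (Finset.card_le_card (t := {⟨x, y⟩, ⟨y, x⟩}) fun t ht => ?_).trans
            Finset.card_le_two
          obtain ⟨a, b⟩ := t
          have := (Finset.mem_filter.1 ht).2
          rw [Sym2.eq_iff] at this
          rcases this with ⟨rfl, rfl⟩ | ⟨rfl, rfl⟩ <;> simp
  all_goals
    intro e he
    obtain ⟨⟨a, b⟩, ht, rfl⟩ := Finset.mem_image.1 he
    obtain ⟨ha, hb⟩ := (hQ _).1 ht
    simp only at ha hb
  · simpa using hne a ha b hb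
  · intro hab
    rcases hboost a ha b hb F le_rfl hab with h | ⟨l', hl', hlt⟩
    · exact hham h
    · exact lt_irrefl _ (hlt l' hl')
  · exact ⟨a, ha, by simp⟩
  · intro F' hle hab
    exact hboost a ha b hb F' hle hab

end SimpleGraph

/-! ### Edge sets of random graphs -/

namespace SimpleGraph

open MeasureTheory

variable {V : Type*} [Fintype V]

/-- The edge set of a graph on a finite vertex set as a `Finset`, with no decidability assumption on
the adjacency relation. -/
noncomputable def edges (G : SimpleGraph V) : Finset (Sym2 V) :=
  G.edgeSet.toFinite.toFinset

@[simp] lemma mem_edges {G : SimpleGraph V} {e : Sym2 V} : e ∈ G.edges ↔ e ∈ G.edgeSet := by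
  simp [edges]

lemma edges_subset_edges {G H : SimpleGraph V} : G.edges ⊆ H.edges ↔ G ≤ H := by
  rw [← edgeSet_subset_edgeSet]
  exact ⟨fun h e he => mem_edges.1 (h (mem_edges.2 he)),
    fun h e he => mem_edges.2 (h (mem_edges.1 he))⟩

lemma mem_edges_top {e : Sym2 V} : e ∈ (⊤ : SimpleGraph V).edges ↔ ¬ e.IsDiag := by
  induction e with | h x y => simp

lemma fromEdgeSet_edges (G : SimpleGraph V) : fromEdgeSet (G.edges : Set (Sym2 V)) = G := by
  simp [edges]

lemma edges_fromEdgeSet {S : Finset (Sym2 V)} (hS : S ⊆ (⊤ : SimpleGraph V).edges) :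
    (fromEdgeSet (S : Set (Sym2 V))).edges = S := by
  ext e
  have := fun h : e ∈ S => mem_edges_top.1 (hS h)
  simp only [mem_edges, edgeSet_fromEdgeSet, Set.mem_sdiff, Finset.mem_coe]
  constructor
  · exact fun h => h.1
  · exact fun h => ⟨h, by simpa using this h⟩

variable [DecidableEq V]

lemma card_edges_top : (⊤ : SimpleGraph V).edges.card = (Fintype.card V).choose 2 := by
  rw [← card_edgeFinset_top_eq_card_choose_two]
  congr 1
  ext e
  simp

lemma binomialRandom_real_singleton (p : unitInterval) (G : SimpleGraph V) :
    (binomialRandom V p).real {G} = binomialWeight (⊤ : SimpleGraph V).edges p G.edges := by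
  have hsub : G.edges ⊆ (⊤ : SimpleGraph V).edges := edges_subset_edges.2 le_top
  rw [measureReal_def, binomialRandom_singleton, binomialWeight, Finset.card_sdiff_of_subset hsub,
    card_edges_top, Nat.card_eq_fintype_card, edges, ← Set.ncard_eq_toFinset_card]
  simp

/-- Events about the edge set of a random graph, in terms of binomial weights. -/
lemma binomialRandom_real_le (p : unitInterval) (Q : Finset (Sym2 V) → Prop) [DecidablePred Q] :
    (binomialRandom V p).real {G | Q G.edges} ≤
      ∑ S ∈ (⊤ : SimpleGraph V).edges.powerset with Q S,
        binomialWeight (⊤ : SimpleGraph V).edges p S := by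
  calc _ ≤ (binomialRandom V p).real (⋃ S ∈ {S ∈ (⊤ : SimpleGraph V).edges.powerset | Q S},
          {fromEdgeSet (S : Set (Sym2 V))}) := by
        refine measureReal_mono (fun G hG => ?_) (measure_ne_top _ _)
        simp only [Set.mem_iUnion, Set.mem_singleton_iff]
        exact ⟨G.edges, Finset.mem_filter.2 ⟨Finset.mem_powerset.2 (edges_subset_edges.2 le_top),
          hG⟩, G.fromEdgeSet_edges.symm⟩
    _ ≤ _ := by
        refine (measureReal_biUnion_finset_le _ _).trans (Finset.sum_le_sum fun S hS => ?_)
        rw [binomialRandom_real_singleton,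
          edges_fromEdgeSet (Finset.mem_powerset.1 (Finset.mem_filter.1 hS).1)]

lemma binomialRandom_real_exists_le {ι : Type*} (p : unitInterval) (T : Finset ι)
    (Q : ι → Finset (Sym2 V) → Prop) [∀ i, DecidablePred (Q i)] :
    (binomialRandom V p).real {G | ∃ i ∈ T, Q i G.edges} ≤
      ∑ i ∈ T, ∑ S ∈ (⊤ : SimpleGraph V).edges.powerset with Q i S,
        binomialWeight (⊤ : SimpleGraph V).edges p S := by
  have : {G : SimpleGraph V | ∃ i ∈ T, Q i G.edges} = ⋃ i ∈ T, {G | Q i G.edges} := by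
    ext G; simp
  rw [this]
  exact (measureReal_biUnion_finset_le _ _).trans
    (Finset.sum_le_sum fun i _ => binomialRandom_real_le p (Q i))

lemma card_edges_top_le : ((⊤ : SimpleGraph V).edges.card : ℝ) ≤ (Fintype.card V : ℝ) ^ 2 / 2 := by
  rw [card_edges_top]
  refine (Nat.choose_le_pow_div 2 _).trans ?_
  simp [Nat.factorial]

/-! ### Cuts of random graphs -/

/-- The pairs consisting of a vertex in `U` and a vertex outside `X`. -/
def cut (U X : Finset V) : Finset (Sym2 V) :=
  (U ×ˢ Xᶜ).image fun t => s(t.1, t.2)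

lemma mem_cut {U X : Finset V} {e : Sym2 V} : e ∈ cut U X ↔ ∃ u ∈ U, ∃ w ∉ X, s(u, w) = e := by
  simp [cut, and_assoc]

lemma card_cut {U X : Finset V} (h : U ⊆ X) : (cut U X).card = U.card * Xᶜ.card := by
  rw [cut, Finset.card_image_of_injOn, Finset.card_product]
  rintro ⟨a, b⟩ hab ⟨c, d⟩ hcd heq
  simp only [Finset.coe_product, Set.mem_prod, Finset.mem_coe, Finset.mem_compl] at hab hcd
  simp only [Sym2.eq_iff] at heq
  rcases heq with ⟨rfl, rfl⟩ | ⟨rfl, rfl⟩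
  · rfl
  · exact absurd (h hab.1) hcd.2

lemma cut_subset_edges_top {U X : Finset V} (h : U ⊆ X) : cut U X ⊆ (⊤ : SimpleGraph V).edges := by
  intro e he
  obtain ⟨u, hu, w, hw, rfl⟩ := mem_cut.1 he
  rw [mem_edges_top, Sym2.mk_isDiag_iff]
  rintro rfl
  exact hw (h hu)

open scoped Classical in
variable (V) in
/-- The pairs `(U, X)` for which the cut between `U` and the complement of `X` must contain edges:
`X` is at most three times as large as its nonempty subset `U`, and the complement of `X` is not
too small. -/
noncomputable def expansionPairs (θ : ℝ) : Finset (Finset V × Finset V) :=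
  {t | t.1.Nonempty ∧ t.1 ⊆ t.2 ∧ t.2.card ≤ 3 * t.1.card ∧
    (t.2.card : ℝ) ≤ (1 - θ) * Fintype.card V}

lemma mem_expansionPairs {θ : ℝ} {t : Finset V × Finset V} :
    t ∈ expansionPairs V θ ↔ t.1.Nonempty ∧ t.1 ⊆ t.2 ∧ t.2.card ≤ 3 * t.1.card ∧
      (t.2.card : ℝ) ≤ (1 - θ) * Fintype.card V := by
  simp [expansionPairs]

lemma card_compl_of_mem_expansionPairs {θ : ℝ} {t : Finset V × Finset V}
    (ht : t ∈ expansionPairs V θ) : θ * Fintype.card V ≤ (t.2ᶜ.card : ℝ) := by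
  have h1 := (mem_expansionPairs.1 ht).2.2.2
  have h2 : (t.2.card : ℝ) + t.2ᶜ.card = Fintype.card V := by
    exact_mod_cast Finset.card_add_card_compl t.2
  linarith

/-- The bound for a union over `expansionPairs` in which a pair `(U, X)` costs `exp (-4 r |U|)`. -/
noncomputable def unionBound (n : ℕ) (r : ℝ) : ℝ :=
  ((1 + Real.exp (-r)) ^ n - 1) * (1 + Real.exp (-r)) ^ n

lemma sum_expansionPairs_le {θ r : ℝ} (hr : 0 ≤ r) (f : Finset V × Finset V → ℝ)
    (hf : ∀ t ∈ expansionPairs V θ, 4 * r * t.1.card ≤ f t) :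
    ∑ t ∈ expansionPairs V θ, Real.exp (-f t) ≤ unionBound (Fintype.card V) r := by
  refine le_trans (Finset.sum_le_sum fun t ht => ?_) (sum_pow_card_le (Real.exp_pos (-r)).le
    (Real.exp_le_one_iff.2 (neg_nonpos.2 hr)) (expansionPairs V θ)
    fun t ht => ⟨(mem_expansionPairs.1 ht).1, (mem_expansionPairs.1 ht).2.2.1⟩)
  rw [← Real.exp_nat_mul]
  have := hf t ht
  apply Real.exp_le_exp.2
  push_cast
  linarith

lemma binomialRandom_real_cut_lower_tail (p : unitInterval) {θ η r : ℝ} (hη : 0 ≤ η)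
    (hr : 0 ≤ r) (hr' : 16 * r ≤ η ^ 2 * p * (θ * Fintype.card V)) :
    (binomialRandom V p).real {G | ∃ t ∈ expansionPairs V θ,
      ((G.edges ∩ cut t.1 t.2).card : ℝ) < (1 - η) * p * (cut t.1 t.2).card} ≤
      unionBound (Fintype.card V) r := by
  calc _ ≤ ∑ t ∈ expansionPairs V θ, ∑ S ∈ (⊤ : SimpleGraph V).edges.powerset with
          ((S ∩ cut t.1 t.2).card : ℝ) < (1 - η) * p * (cut t.1 t.2).card,
          binomialWeight (⊤ : SimpleGraph V).edges p S :=
        binomialRandom_real_exists_le p (expansionPairs V θ) fun t S =>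
          ((S ∩ cut t.1 t.2).card : ℝ) < (1 - η) * p * (cut t.1 t.2).card
    _ ≤ ∑ t ∈ expansionPairs V θ, Real.exp (-(η ^ 2 * p * (cut t.1 t.2).card / 4)) :=
        Finset.sum_le_sum fun t ht => ?_
    _ ≤ _ := sum_expansionPairs_le (θ := θ) hr
        (fun t => η ^ 2 * p * (cut t.1 t.2).card / 4) fun t ht => ?_
  · have := sum_binomialWeight_lower_tail (Finset.empty_subset _)
      (cut_subset_edges_top (mem_expansionPairs.1 ht).2.1) (Finset.disjoint_empty_left _)
      p.2.1 p.2.2 hη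
    simpa using this
  · have h1 := card_compl_of_mem_expansionPairs ht
    rw [card_cut (mem_expansionPairs.1 ht).2.1]
    push_cast
    have h0 : (0 : ℝ) ≤ p := p.2.1
    have h2 : η ^ 2 * p * (θ * Fintype.card V) ≤ η ^ 2 * p * (t.2ᶜ.card : ℝ) :=
      mul_le_mul_of_nonneg_left h1 (by positivity)
    have h3 := mul_le_mul_of_nonneg_right (hr'.trans h2) (Nat.cast_nonneg (α := ℝ) t.1.card)
    linarith

lemma binomialRandom_real_card_edges (p : unitInterval) :
    (binomialRandom V p).real {G | 2 * p * (Fintype.card V : ℝ) ^ 2 ≤ (G.edges.card : ℝ)} ≤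
      Real.exp (-(p * (Fintype.card V : ℝ) ^ 2)) := by
  classical
  refine (binomialRandom_real_le p fun S =>
    2 * p * (Fintype.card V : ℝ) ^ 2 ≤ (S.card : ℝ)).trans ?_
  refine (sum_binomialWeight_upper_tail _ p.2.1 p.2.2 _).trans (Real.exp_le_exp.2 ?_)
  have := mul_le_mul_of_nonneg_left (card_edges_top_le (V := V)) p.2.1
  linarith

/-- Let `Φ` assign a set of test pairs to every graph. The probability that the random graph has a
sparse subgraph `F`, for which `Φ F` is large and consists of non-edges of `F`, but contains fewer
elements of `Φ F` than expected. A union over `Φ F` is not needed, because `F` determines it. -/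
lemma binomialRandom_real_sparse_subgraph (p : unitInterval)
    (Φ : SimpleGraph V → Finset (Sym2 V)) {η m a L : ℝ} (hη : 0 ≤ η) (hL : 0 ≤ L) :
    (binomialRandom V p).real {G | ∃ F ≤ G, (F.edges.card : ℝ) ≤ m ∧ a ≤ ((Φ F).card : ℝ) ∧
      (∀ e ∈ Φ F, ¬ e.IsDiag ∧ e ∉ F.edgeSet) ∧
      ((G.edges ∩ Φ F).card : ℝ) < (1 - η) * p * (Φ F).card} ≤
      Real.exp (L * m + p * Real.exp (-L) * ((Fintype.card V : ℝ) ^ 2 / 2) -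
        η ^ 2 * p * a / 4) := by
  classical
  have h0 : (0 : ℝ) ≤ p := p.2.1
  let Ψ : Finset (Sym2 V) → Finset (Sym2 V) := fun S => Φ (fromEdgeSet S)
  let T : Finset (Finset (Sym2 V)) := {S ∈ (⊤ : SimpleGraph V).edges.powerset |
    Ψ S ⊆ (⊤ : SimpleGraph V).edges ∧ Disjoint S (Ψ S) ∧ (S.card : ℝ) ≤ m ∧ a ≤ ((Ψ S).card : ℝ)}
  have hT : ∀ S ∈ T, S ⊆ (⊤ : SimpleGraph V).edges ∧ Ψ S ⊆ (⊤ : SimpleGraph V).edges ∧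
      Disjoint S (Ψ S) ∧ (S.card : ℝ) ≤ m ∧ a ≤ ((Ψ S).card : ℝ) := by
    intro S hS
    have := Finset.mem_filter.1 hS
    exact ⟨Finset.mem_powerset.1 this.1, this.2⟩
  calc _ ≤ (binomialRandom V p).real {G | ∃ S ∈ T, S ⊆ G.edges ∧
          ((G.edges ∩ Ψ S).card : ℝ) < (1 - η) * p * (Ψ S).card} := by
        refine measureReal_mono ?_ (measure_ne_top _ _)
        rintro G ⟨F, hFG, hm, ha, hd, hlt⟩
        have hΨ : Ψ F.edges = Φ F := by simp only [Ψ, fromEdgeSet_edges]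
        refine ⟨F.edges, Finset.mem_filter.2 ⟨Finset.mem_powerset.2 (edges_subset_edges.2 le_top),
          ?_, ?_, hm, ?_⟩, edges_subset_edges.2 hFG, ?_⟩
        · rw [hΨ]
          exact fun e he => mem_edges_top.2 (hd e he).1
        · rw [hΨ, Finset.disjoint_right]
          exact fun e he => by simpa using (hd e he).2
        · rwa [hΨ]
        · rwa [hΨ]
    _ ≤ _ := binomialRandom_real_exists_le p T fun F S => F ⊆ S ∧
          ((S ∩ Ψ F).card : ℝ) < (1 - η) * p * (Ψ F).card
    _ ≤ _ := sum_sum_binomialWeight_lower_tail Ψ T h0 p.2.2 hη hL hT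
    _ ≤ _ := by
        apply Real.exp_le_exp.2
        have := mul_le_mul_of_nonneg_left (card_edges_top_le (V := V))
          (mul_nonneg h0 (Real.exp_pos (-L)).le)
        linarith

end SimpleGraph

/-! ### Hamilton cycles in pseudorandom graphs -/

namespace SimpleGraph

variable {V : Type*} [Fintype V] [DecidableEq V]

/-- Sampling the edges of `Γ` at rate `q` yields a sparse double expander. -/
lemma exists_sparse_isDoubleExpander {Γ : SimpleGraph V} {θ c M q r : ℝ} {k : ℕ}
    (hcut : ∀ t ∈ expansionPairs V θ, c * t.1.card ≤ ((Γ.edges ∩ cut t.1 t.2).card : ℝ))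
    (hM : (Γ.edges.card : ℝ) ≤ M) (h0 : 0 ≤ q) (h1 : q ≤ 1) (hr : 0 ≤ r) (hrc : 4 * r ≤ q * c)
    (hlt : Real.exp (-(q * M)) + unionBound (Fintype.card V) r < 1)
    (hk : (3 * k : ℝ) ≤ (1 - θ) * Fintype.card V) :
    ∃ F ≤ Γ, (F.edges.card : ℝ) ≤ 3 * q * M ∧ F.IsDoubleExpander k := by
  obtain ⟨S, hS, hcard, hmeet⟩ := exists_subset_card_lt_forall_inter_nonempty
    (expansionPairs V θ) (fun t => Γ.edges ∩ cut t.1 t.2) (E := Γ.edges)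
    (fun t _ => Finset.inter_subset_left) h0 h1 (a := 3 * q * M) (by
      refine lt_of_le_of_lt (add_le_add (Real.exp_le_exp.2 ?_) ?_) hlt
      · have := mul_le_mul_of_nonneg_left hM h0
        linarith
      · refine sum_expansionPairs_le hr (fun t => q * ((Γ.edges ∩ cut t.1 t.2).card : ℝ))
          fun t ht => ?_
        have h2 := mul_le_mul_of_nonneg_left (hcut t ht) h0
        have h3 := mul_le_mul_of_nonneg_right hrc (Nat.cast_nonneg (α := ℝ) t.1.card)
        linarith)
  have hedges : (fromEdgeSet (S : Set (Sym2 V))).edges = S :=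
    edges_fromEdgeSet (hS.trans (edges_subset_edges.2 le_top))
  refine ⟨fromEdgeSet S, edges_subset_edges.1 (by rwa [hedges]),
    by rw [hedges]; exact hcard.le, ?_⟩
  intro U X hU hUk hUX hX
  have hX' : (X.card : ℝ) ≤ (1 - θ) * Fintype.card V := by
    refine le_trans ?_ hk
    exact_mod_cast (show X.card ≤ 3 * k by omega)
  obtain ⟨e, he⟩ := hmeet (U, X) (mem_expansionPairs.2 ⟨hU, hUX, hX.le, hX'⟩)
  simp only [Finset.mem_inter] at he
  obtain ⟨u, hu, w, hw, rfl⟩ := mem_cut.1 he.2.2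
  refine ⟨u, hu, w, hw, ?_⟩
  rw [← hedges] at he
  exact mem_edges.1 he.1

/-- At most `|A| Δ(H)` edges of `H` meet the vertex set `A`. -/
lemma card_edges_inter_le (H : SimpleGraph V) [DecidableRel H.Adj] (A : Finset V)
    (P : Finset (Sym2 V)) (hP : ∀ e ∈ P, ∃ a ∈ A, a ∈ e) :
    (H.edges ∩ P).card ≤ A.card * H.maxDegree := by
  calc (H.edges ∩ P).card ≤ (A.biUnion fun a => H.incidenceFinset a).card := by
        refine Finset.card_le_card fun e he => ?_
        obtain ⟨heH, heP⟩ := Finset.mem_inter.1 he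
        obtain ⟨a, ha, hae⟩ := hP e heP
        exact Finset.mem_biUnion.2 ⟨a, ha, by
          rw [mem_incidenceFinset]; exact ⟨mem_edges.1 heH, hae⟩⟩
    _ ≤ A.card * H.maxDegree := Finset.card_biUnion_le_card_mul _ _ _ fun a _ => by
        rw [card_incidenceFinset_eq_degree]; exact H.degree_le_maxDegree a

lemma card_edges_inter_le_add (G H : SimpleGraph V) (P : Finset (Sym2 V)) :
    (G.edges ∩ P).card ≤ ((G \ H).edges ∩ P).card + (H.edges ∩ P).card := by
  refine (Finset.card_le_card fun e he => ?_).trans (Finset.card_union_le _ _)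
  simp only [Finset.mem_inter, Finset.mem_union, mem_edges, edgeSet_sdiff, Set.mem_sdiff] at he ⊢
  tauto

/-- If every non-Hamiltonian graph between `F₀` and `Γ` with at most `n` more edges than `F₀` has a
booster in `Γ`, then `Γ` is Hamiltonian: every booster added
lengthens the longest path, which can happen at most `n` times. -/
lemma isHamiltonian_of_exists_boost {F₀ Γ : SimpleGraph V} (hle : F₀ ≤ Γ)
    (hstep : ∀ F, F₀ ≤ F → F ≤ Γ → F.edges.card ≤ F₀.edges.card + Fintype.card V →
      ¬ F.IsHamiltonian → ∃ e ∈ Γ.edgeSet, ∀ F' : SimpleGraph V, F ≤ F' → e ∈ F'.edgeSet →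
        F'.IsHamiltonian ∨ ∃ l', F'.IsPathList l' ∧ ∀ l, F.IsPathList l → l.length < l'.length) :
    Γ.IsHamiltonian := by
  by_contra hΓ
  have key : ∀ i ≤ Fintype.card V + 1, ∃ F, F₀ ≤ F ∧ F ≤ Γ ∧
      F.edges.card ≤ F₀.edges.card + i ∧ ∃ l, F.IsPathList l ∧ i ≤ l.length := by
    intro i
    induction i with
    | zero =>
      intro _
      exact ⟨F₀, le_rfl, hle, le_rfl, [], ⟨List.isChain_nil, List.nodup_nil⟩, le_rfl⟩
    | succ i ih =>
      intro hi
      obtain ⟨F, hF, hFΓ, hcard, l, hl, hil⟩ := ih (by omega)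
      obtain ⟨e, he, hboost⟩ := hstep F hF hFΓ (by omega) fun h => hΓ (h.mono hFΓ)
      have hlt : F ⊔ fromEdgeSet {e} ≤ Γ := by
        refine sup_le hFΓ ?_
        rw [← edgeSet_subset_edgeSet, edgeSet_fromEdgeSet]
        rintro _ ⟨rfl, -⟩
        exact he
      have hmem : e ∈ (F ⊔ fromEdgeSet {e}).edgeSet := by
        rw [edgeSet_sup, edgeSet_fromEdgeSet]
        exact Or.inr ⟨rfl, Γ.not_isDiag_of_mem_edgeSet he⟩
      refine ⟨F ⊔ fromEdgeSet {e}, hF.trans le_sup_left, hlt, ?_, ?_⟩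
      · have : (F ⊔ fromEdgeSet {e}).edges ⊆ insert e F.edges := by
          intro x hx
          rw [mem_edges, edgeSet_sup, edgeSet_fromEdgeSet] at hx
          rcases hx with hx | hx
          · exact Finset.mem_insert_of_mem (mem_edges.2 hx)
          · rw [hx.1]
            exact Finset.mem_insert_self _ _
        have := (Finset.card_le_card this).trans (Finset.card_insert_le _ _)
        omega
      · rcases hboost _ le_sup_left hmem with h | ⟨l', hl', h⟩
        · exact absurd (h.mono hlt) hΓ
        · exact ⟨l', hl', lt_of_le_of_lt hil (h l hl)⟩
  obtain ⟨F, -, -, -, l, hl, hlen⟩ := key _ le_rfl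
  have := hl.2.length_le_card
  omega

open scoped Classical in
/-- A choice of a booster set for every graph that has one, and `∅` for the others. -/
noncomputable def boosters (k : ℕ) (F : SimpleGraph V) : Finset (Sym2 V) :=
  if h : ∃ P A, F.IsBoosterSet k A P then h.choose else ∅

lemma exists_isBoosterSet_boosters {k : ℕ} {F : SimpleGraph V}
    (h : ∃ A P, F.IsBoosterSet k A P) : ∃ A, F.IsBoosterSet k A (boosters k F) := by
  have h' : ∃ P A, F.IsBoosterSet k A P := by
    obtain ⟨A, P, h⟩ := h
    exact ⟨P, A, h⟩
  rw [boosters, dif_pos h']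
  exact h'.choose_spec

lemma boosters_not_isDiag {k : ℕ} {F : SimpleGraph V} :
    ∀ e ∈ boosters k F, ¬ e.IsDiag ∧ e ∉ F.edgeSet := by
  intro e he
  by_cases h : ∃ A P, F.IsBoosterSet k A P
  · obtain ⟨A, hA⟩ := exists_isBoosterSet_boosters h
    exact ⟨hA.not_isDiag e he, hA.notMem_edgeSet e he⟩
  · have h' : ¬ ∃ P A, F.IsBoosterSet k A P := fun ⟨P, A, h'⟩ => h ⟨A, P, h'⟩
    simp [boosters, dif_neg h'] at he

/-- After the removal of `H`, the cuts of `expansionPairs` keep a positive proportion of their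
expected size. For `U` and `W = Xᶜ`, the graph `H` removes at most `min |U| |W|` times its maximum
degree, and the larger of `U` and `W` has at least `n / 6` vertices. -/
lemma le_card_edges_sdiff_inter_cut {G H : SimpleGraph V} [DecidableRel H.Adj] {p ε : ℝ}
    (hε : 0 < ε) (hε1 : ε < 1) (hp : 0 < p)
    (hH : (H.maxDegree : ℝ) ≤ (1 - ε) * Fintype.card V * p / 6)
    {t : Finset V × Finset V} (ht : t ∈ expansionPairs V (ε / 4))
    (hG : (1 - ε / 4) * p * (cut t.1 t.2).card ≤ ((G.edges ∩ cut t.1 t.2).card : ℝ)) :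
    ε ^ 2 / 32 * (p * Fintype.card V) * t.1.card ≤ (((G \ H).edges ∩ cut t.1 t.2).card : ℝ) := by
  obtain ⟨hU, hUX, hX3, hX⟩ := mem_expansionPairs.1 ht
  have hw := card_compl_of_mem_expansionPairs ht
  have hsum : (t.2.card : ℝ) + t.2ᶜ.card = Fintype.card V := by
    exact_mod_cast Finset.card_add_card_compl t.2
  have hX3' : (t.2.card : ℝ) ≤ 3 * t.1.card := by exact_mod_cast hX3
  have hUn : (t.1.card : ℝ) ≤ Fintype.card V := by exact_mod_cast Finset.card_le_univ t.1
  have hadd : ((G.edges ∩ cut t.1 t.2).card : ℝ) ≤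
      ((G \ H).edges ∩ cut t.1 t.2).card + (H.edges ∩ cut t.1 t.2).card := by
    exact_mod_cast card_edges_inter_le_add G H (cut t.1 t.2)
  have hH1 : ((H.edges ∩ cut t.1 t.2).card : ℝ) ≤ t.1.card * H.maxDegree := by
    exact_mod_cast card_edges_inter_le H t.1 _ fun e he => by
      obtain ⟨u, hu, w, hw, rfl⟩ := mem_cut.1 he
      exact ⟨u, hu, by simp⟩
  have hH2 : ((H.edges ∩ cut t.1 t.2).card : ℝ) ≤ t.2ᶜ.card * H.maxDegree := by
    exact_mod_cast card_edges_inter_le H t.2ᶜ _ fun e he => by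
      obtain ⟨u, hu, w, hw, rfl⟩ := mem_cut.1 he
      exact ⟨w, by simpa using hw, by simp⟩
  have hcut : ((cut t.1 t.2).card : ℝ) = t.1.card * t.2ᶜ.card := by
    exact_mod_cast card_cut hUX
  rw [hcut] at hG
  have hu0 : (0 : ℝ) ≤ t.1.card := Nat.cast_nonneg _
  have hw0 : (0 : ℝ) ≤ t.2ᶜ.card := Nat.cast_nonneg _
  set n : ℝ := (Fintype.card V : ℝ) with hn
  set u : ℝ := (t.1.card : ℝ)
  set w : ℝ := (t.2ᶜ.card : ℝ)
  have hn0 : 0 ≤ n := Nat.cast_nonneg _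
  -- the surplus at every vertex of the smaller side, when the larger side has `y` vertices
  have hgap : ∀ y : ℝ, n / 6 ≤ y → ε / 8 * (p * n) ≤
      (1 - ε / 4) * p * y - (1 - ε) * n * p / 6 := by
    intro y hy
    have : (1 - ε / 4) * p * (n / 6) ≤ (1 - ε / 4) * p * y :=
      mul_le_mul_of_nonneg_left hy (mul_nonneg (by linarith) hp.le)
    linarith
  have hpn : 0 ≤ p * n := by positivity
  rcases le_total (n / 6) u with h | h
  · have h1 := mul_le_mul_of_nonneg_left (hgap u h) hw0
    have h2 := mul_le_mul_of_nonneg_left hH hw0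
    have h3 : ε / 4 * u ≤ w := (mul_le_mul_of_nonneg_left hUn (by linarith)).trans hw
    have h4 := mul_le_mul_of_nonneg_right h3 (show 0 ≤ ε / 8 * (p * n) by positivity)
    nlinarith
  · have hwn : n / 6 ≤ w := by linarith
    have h1 := mul_le_mul_of_nonneg_left (hgap w hwn) hu0
    have h2 := mul_le_mul_of_nonneg_left hH hu0
    have h4 : ε ^ 2 / 32 * (p * n) * u ≤ ε / 8 * (p * n) * u := by
      have : ε ^ 2 / 32 ≤ ε / 8 := by nlinarith
      gcongr
    nlinarith

/-- The deterministic core: a graph `G` whose cuts have about the expected size, in which every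
sparse subgraph sees about the expected number of edges among its boosters, remains Hamiltonian
after the removal of `H`. The boosters of `F` meet the set `A` of endpoints, so `H` contains at most
`|A| Δ(H)` of them, while `G` contains about `p |A| n / 6`. -/
theorem isHamiltonian_sdiff_of_pseudorandom [Nonempty V] {G H : SimpleGraph V} [DecidableRel H.Adj]
    {p ε γ r : ℝ} {k : ℕ} (hε : 0 < ε) (hε1 : ε < 1) (hp : 0 < p) (hγ : 0 ≤ γ) (hγ1 : γ ≤ 1)
    (hr : 0 ≤ r) (hk : k = ⌊(1 - ε / 4) * Fintype.card V / 3⌋₊) (hn : 25 ≤ Fintype.card V)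
    (hγn : (Fintype.card V : ℝ) ≤ γ / 2 * (p * (Fintype.card V : ℝ) ^ 2))
    (hrn : 4 * r ≤ γ / 12 * (ε ^ 2 / 32 * (p * Fintype.card V)))
    (hlt : Real.exp (-(γ / 6 * (p * (Fintype.card V : ℝ) ^ 2))) +
      unionBound (Fintype.card V) r < 1)
    (hcut : ∀ t ∈ expansionPairs V (ε / 4),
      (1 - ε / 4) * p * (cut t.1 t.2).card ≤ ((G.edges ∩ cut t.1 t.2).card : ℝ))
    (hboost : ∀ F ≤ G, (F.edges.card : ℝ) ≤ γ * (p * (Fintype.card V : ℝ) ^ 2) →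
      (Fintype.card V : ℝ) ^ 2 / 32 ≤ (boosters k F).card →
      (1 - ε / 4) * p * (boosters k F).card ≤ ((G.edges ∩ boosters k F).card : ℝ))
    (hG : (G.edges.card : ℝ) ≤ 2 * p * (Fintype.card V : ℝ) ^ 2)
    (hH : (H.maxDegree : ℝ) ≤ (1 - ε) * Fintype.card V * p / 6) : (G \ H).IsHamiltonian := by
  have hn' : (25 : ℝ) ≤ Fintype.card V := by exact_mod_cast hn
  set n : ℝ := (Fintype.card V : ℝ) with hndef
  have hkle : (k : ℝ) ≤ (1 - ε / 4) * n / 3 := by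
    rw [hk]
    exact Nat.floor_le (by apply div_nonneg (mul_nonneg _ _) <;> linarith)
  have hklt : (1 - ε / 4) * n / 3 < k + 1 := by
    rw [hk]
    exact Nat.lt_floor_add_one _
  have hk4 : n / 4 < k + 1 := by nlinarith
  have hk6 : Fintype.card V < 6 * k := by
    have : n < 6 * k := by linarith
    rw [hndef] at this
    exact_mod_cast this
  have hk2 : 2 ≤ k := by omega
  have hpn : 0 ≤ p * n ^ 2 := by positivity
  obtain ⟨F₀, hF₀, hcard, hexp⟩ := exists_sparse_isDoubleExpander (Γ := G \ H) (θ := ε / 4)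
    (c := ε ^ 2 / 32 * (p * n)) (M := 2 * p * n ^ 2) (q := γ / 12) (r := r) (k := k)
    (fun t ht => le_card_edges_sdiff_inter_cut hε hε1 hp hH ht (hcut t ht))
    ((Nat.cast_le.2 (Finset.card_le_card (edges_subset_edges.2 sdiff_le))).trans hG)
    (by linarith) (by linarith) hr hrn
    (by rwa [show γ / 12 * (2 * p * n ^ 2) = γ / 6 * (p * n ^ 2) by ring]) (by linarith)
  refine isHamiltonian_of_exists_boost hF₀ fun F hF hFΓ hFcard hham => ?_
  obtain ⟨A, hA⟩ := exists_isBoosterSet_boosters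
    ((hexp.mono hF).exists_isBoosterSet hk6 hk2 hham)
  set P := boosters k F
  have hAk : (k : ℝ) + 1 ≤ A.card := by exact_mod_cast hA.lt_card
  have hAP : (A.card : ℝ) * (k + 1) ≤ 2 * P.card := by exact_mod_cast hA.card_mul_le
  have hPn : n ^ 2 / 32 ≤ P.card := by nlinarith
  have hFG : (F.edges.card : ℝ) ≤ γ * (p * n ^ 2) := by
    have : (F.edges.card : ℝ) ≤ F₀.edges.card + n := by rw [hndef]; exact_mod_cast hFcard
    linarith
  have hPG := hboost F (hFΓ.trans sdiff_le) hFG hPn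
  have hPH : ((H.edges ∩ P).card : ℝ) ≤ A.card * H.maxDegree := by
    exact_mod_cast card_edges_inter_le H A P hA.exists_mem
  have hadd : ((G.edges ∩ P).card : ℝ) ≤ ((G \ H).edges ∩ P).card + (H.edges ∩ P).card := by
    exact_mod_cast card_edges_inter_le_add G H P
  have hpos : (0 : ℝ) < ((G \ H).edges ∩ P).card := by
    have hA0 : (0 : ℝ) < A.card := by linarith
    have h1 : (A.card : ℝ) * H.maxDegree ≤ A.card * ((1 - ε) * n * p / 6) := by gcongr
    have h2 : (A.card : ℝ) * ((1 - ε / 4) * n / 3) ≤ 2 * P.card :=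
      (mul_le_mul_of_nonneg_left hklt.le hA0.le).trans hAP
    have h3 : (1 - ε / 4) * p * (A.card * ((1 - ε / 4) * n / 3)) ≤
        (1 - ε / 4) * p * (2 * P.card) :=
      mul_le_mul_of_nonneg_left h2 (mul_nonneg (by linarith) hp.le)
    have h4 : 0 < A.card * (n * p) * ((1 - ε / 4) * (1 - ε / 4) - (1 - ε)) := by
      have : 0 < (1 - ε / 4) * (1 - ε / 4) - (1 - ε) := by nlinarith
      positivity
    linarith
  obtain ⟨e, he⟩ := Finset.card_pos.1 (Nat.cast_pos.1 hpos)
  rw [Finset.mem_inter] at he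
  exact ⟨e, mem_edges.1 he.1, hA.boost e he.2⟩

end SimpleGraph

/-! ### The resilience of random graphs -/

namespace SimpleGraph

open MeasureTheory

variable {V : Type*} [Fintype V] [DecidableEq V]

/-- Only deletions matter for the resilience of an increasing property. -/
lemma ofReal_le_localResilience {G : SimpleGraph V} {d : ℝ}
    (h : ∀ (H : SimpleGraph V) [DecidableRel H.Adj], (H.maxDegree : ℝ) ≤ d →
      (G \ H).IsHamiltonian) :
    ENNReal.ofReal d ≤ ((localResilience G fun G' => G'.IsHamiltonian : ℕ∞) : ℝ≥0∞) := by
  have hceil : ((⌈d⌉₊ : ℕ) : ℕ∞) ≤ localResilience G fun G' => G'.IsHamiltonian := by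
    classical
    refine le_iInf₂ fun H hH => ?_
    by_contra! hlt
    have hlt' := Nat.cast_lt.1 hlt
    exact hH ((@h H (Classical.decRel _) (Nat.lt_ceil.1 hlt').le).mono le_sup_left)
  calc ENNReal.ofReal d ≤ ENNReal.ofReal (⌈d⌉₊ : ℕ) := ENNReal.ofReal_le_ofReal (Nat.le_ceil d)
    _ = (((⌈d⌉₊ : ℕ) : ℕ∞) : ℝ≥0∞) := by simp
    _ ≤ _ := ENat.toENNReal_mono hceil

/-- The probability that the random graph fails to be resilient, in terms of the failure
probabilities for its cuts, for the boosters of its sparse subgraphs and for its number of edges. -/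
lemma one_sub_le_binomialRandom_real [Nonempty V] (p : unitInterval) {ε γ r L : ℝ} (hε : 0 < ε)
    (hε1 : ε < 1) (hp : 0 < (p : ℝ)) (hγ : 0 ≤ γ) (hγ1 : γ ≤ 1) (hr : 0 ≤ r) (hL : 0 ≤ L)
    (hn : 25 ≤ Fintype.card V)
    (hγn : (Fintype.card V : ℝ) ≤ γ / 2 * (p * (Fintype.card V : ℝ) ^ 2))
    (hrn : 4 * r ≤ γ / 12 * (ε ^ 2 / 32 * (p * Fintype.card V)))
    (hrn' : 16 * r ≤ (ε / 4) ^ 2 * p * (ε / 4 * Fintype.card V))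
    (hlt : Real.exp (-(γ / 6 * (p * (Fintype.card V : ℝ) ^ 2))) +
      unionBound (Fintype.card V) r < 1) :
    1 - (unionBound (Fintype.card V) r +
      Real.exp (L * (γ * (p * (Fintype.card V : ℝ) ^ 2)) +
        p * Real.exp (-L) * ((Fintype.card V : ℝ) ^ 2 / 2) -
        (ε / 4) ^ 2 * p * ((Fintype.card V : ℝ) ^ 2 / 32) / 4) +
      Real.exp (-(p * (Fintype.card V : ℝ) ^ 2))) ≤
    (binomialRandom V p).real {G | ∀ (H : SimpleGraph V) [DecidableRel H.Adj],
      (H.maxDegree : ℝ) ≤ (1 - ε) * Fintype.card V * p / 6 → (G \ H).IsHamiltonian} := by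
  set k := ⌊(1 - ε / 4) * Fintype.card V / 3⌋₊ with hk
  have h1 := binomialRandom_real_cut_lower_tail (V := V) p (show 0 ≤ ε / 4 by positivity) hr hrn'
  have h2 := binomialRandom_real_sparse_subgraph p (boosters (V := V) k)
    (m := γ * (p * (Fintype.card V : ℝ) ^ 2)) (a := (Fintype.card V : ℝ) ^ 2 / 32)
    (show 0 ≤ ε / 4 by positivity) hL
  have h3 := binomialRandom_real_card_edges (V := V) p
  set A : Set (SimpleGraph V) := {G | ∀ (H : SimpleGraph V) [DecidableRel H.Adj],
      (H.maxDegree : ℝ) ≤ (1 - ε) * Fintype.card V * p / 6 → (G \ H).IsHamiltonian} with hA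
  set B₁ : Set (SimpleGraph V) := {G | ∃ t ∈ expansionPairs V (ε / 4),
      ((G.edges ∩ cut t.1 t.2).card : ℝ) < (1 - ε / 4) * p * (cut t.1 t.2).card} with hB₁
  set B₂ : Set (SimpleGraph V) := {G | ∃ F ≤ G,
      (F.edges.card : ℝ) ≤ γ * (p * (Fintype.card V : ℝ) ^ 2) ∧
      (Fintype.card V : ℝ) ^ 2 / 32 ≤ ((boosters k F).card : ℝ) ∧
      (∀ e ∈ boosters k F, ¬ e.IsDiag ∧ e ∉ F.edgeSet) ∧
      ((G.edges ∩ boosters k F).card : ℝ) < (1 - ε / 4) * p * (boosters k F).card} with hB₂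
  set B₃ : Set (SimpleGraph V) :=
    {G | 2 * p * (Fintype.card V : ℝ) ^ 2 ≤ (G.edges.card : ℝ)} with hB₃
  have hcover : (Set.univ : Set (SimpleGraph V)) ⊆ A ∪ (B₁ ∪ B₂ ∪ B₃) := by
    intro G _
    by_contra hG
    simp only [Set.mem_union, not_or] at hG
    obtain ⟨hGA, ⟨hG₁, hG₂⟩, hG₃⟩ := hG
    refine hGA fun H _ hH => isHamiltonian_sdiff_of_pseudorandom hε hε1 hp hγ hγ1 hr hk hn hγn hrn
      hlt (fun t ht => ?_) (fun F hF hFm hFa => ?_) (not_le.1 hG₃).le hH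
    · by_contra! h
      exact hG₁ ⟨t, ht, h⟩
    · by_contra! h
      exact hG₂ ⟨F, hF, hFm, hFa, boosters_not_isDiag, h⟩
  have h4 : (binomialRandom V p).real Set.univ ≤ _ := measureReal_mono hcover (measure_ne_top _ _)
  have h5 := measureReal_union_le (μ := binomialRandom V p) A (B₁ ∪ B₂ ∪ B₃)
  have h6 := measureReal_union_le (μ := binomialRandom V p) (B₁ ∪ B₂) B₃
  have h7 := measureReal_union_le (μ := binomialRandom V p) B₁ B₂
  rw [probReal_univ] at h4
  linarith

lemma tendsto_unionBound : Tendsto (fun n : ℕ => unionBound n (2 * Real.log n)) atTop (𝓝 0) := by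
  have hlim : Tendsto (fun n : ℕ => Real.exp ((n : ℝ)⁻¹)) atTop (𝓝 1) := by
    have := (Real.continuous_exp.tendsto 0).comp (tendsto_inv_atTop_nhds_zero_nat (𝕜 := ℝ))
    rw [Real.exp_zero] at this
    exact this
  have hlim2 := (hlim.sub_const 1).mul hlim
  rw [sub_self, zero_mul] at hlim2
  refine tendsto_of_tendsto_of_tendsto_of_le_of_le' tendsto_const_nhds hlim2 ?_ ?_
  · refine Eventually.of_forall fun n => ?_
    have : 1 ≤ (1 + Real.exp (-(2 * Real.log n))) ^ n :=
      one_le_pow₀ (by linarith [Real.exp_pos (-(2 * Real.log n))])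
    exact mul_nonneg (by linarith) (by linarith)
  · filter_upwards [eventually_gt_atTop 0] with n hn
    have hn' : (0 : ℝ) < n := by exact_mod_cast hn
    have h1 : 1 ≤ (1 + Real.exp (-(2 * Real.log n))) ^ n :=
      one_le_pow₀ (by linarith [Real.exp_pos (-(2 * Real.log n))])
    have h2 : (1 + Real.exp (-(2 * Real.log n))) ^ n ≤ Real.exp ((n : ℝ)⁻¹) := by
      have he : Real.exp (-(2 * Real.log n)) = (n : ℝ)⁻¹ * (n : ℝ)⁻¹ := by
        rw [two_mul, neg_add, Real.exp_add, Real.exp_neg, Real.exp_log hn']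
      calc (1 + Real.exp (-(2 * Real.log n))) ^ n
          ≤ Real.exp (Real.exp (-(2 * Real.log n))) ^ n := by
            have := Real.add_one_le_exp (Real.exp (-(2 * Real.log n)))
            have := Real.exp_pos (-(2 * Real.log n))
            exact pow_le_pow_left₀ (by linarith) (by linarith) _
        _ = Real.exp ((n : ℝ)⁻¹) := by
            rw [← Real.exp_nat_mul, he, mul_inv_cancel_left₀ hn'.ne']
    exact mul_le_mul (by linarith) h2 (by linarith) (by linarith)

lemma tendsto_exp_neg_mul_natCast {c : ℝ} (hc : 0 < c) :
    Tendsto (fun n : ℕ => Real.exp (-(c * n))) atTop (𝓝 0) :=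
  Real.tendsto_exp_neg_atTop_nhds_zero.comp
    (tendsto_natCast_atTop_atTop.const_mul_atTop hc)

end SimpleGraph

theorem mainTheorem2 (ε : ℝ) (hε : 0 < ε) :
    ∃ K : ℝ, 0 < K ∧ ∀ p : ℕ → unitInterval,
      (∀ᶠ n : ℕ in atTop, K * Real.log n / n ≤ (p n : ℝ)) →
      Tendsto
        (fun n : ℕ => SimpleGraph.binomialRandom (Fin n) (p n)
          {G : SimpleGraph (Fin n) |
            (∀ (H : SimpleGraph (Fin n)) [DecidableRel H.Adj], H ≤ G →
              (H.maxDegree : ℝ) ≤ (1 - ε) * n * (p n : ℝ) / 6 → (G \ H).IsHamiltonian) ∧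
            ENNReal.ofReal ((1 - ε) * n * (p n : ℝ) / 6) ≤
              ((localResilience G fun G' => G'.IsHamiltonian : ℕ∞) : ℝ≥0∞)})
        atTop (𝓝 1) := by
  -- the claim for a smaller `ε` is stronger
  set δ : ℝ := min ε (1 / 2) with hδdef
  have hδ : 0 < δ := lt_min hε (by norm_num)
  have hδ1 : δ < 1 := (min_le_right _ _).trans_lt (by norm_num)
  have hδε : δ ≤ ε := min_le_left _ _
  -- `σ` is a quarter of the Chernoff exponent `(δ / 4) ^ 2 / (32 * 4)` per unit of `p * n ^ 2`;
  -- with `L = σ⁻¹` and `γ = σ ^ 2` the union over sparse graphs costs at most `2 * σ`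
  set σ : ℝ := δ ^ 2 / 8192 with hσdef
  have hσ : 0 < σ := by positivity
  have hσ1 : σ ≤ 1 := by rw [hσdef]; nlinarith
  set γ : ℝ := σ ^ 2 with hγdef
  have hγ : 0 < γ := by positivity
  have hγ1 : γ ≤ 1 := pow_le_one₀ hσ.le hσ1
  have hLσ : Real.exp (-σ⁻¹) ≤ σ := by
    rw [Real.exp_neg]
    refine inv_le_of_inv_le₀ hσ ?_
    linarith [Real.add_one_le_exp σ⁻¹]
  -- the summands of `K` serve, in turn, the cuts of `G`, the sampling of the sparse expander, and
  -- the bounds `n ≤ γ / 2 * (p * n ^ 2)` and `1 ≤ p * n`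
  set K : ℝ := 2048 / δ ^ 3 + 3072 / (γ * δ ^ 2) + 2 / γ + 1 with hKdef
  have hK1 : 2048 / δ ^ 3 ≤ K := by
    have h1 : 0 ≤ 3072 / (γ * δ ^ 2) := by positivity
    have h2 : 0 ≤ 2 / γ := by positivity
    linarith
  have hK2 : 3072 / (γ * δ ^ 2) ≤ K := by
    have h1 : 0 ≤ 2048 / δ ^ 3 := by positivity
    have h2 : 0 ≤ 2 / γ := by positivity
    linarith
  have hK3 : 2 / γ + 1 ≤ K := by
    have h1 : 0 ≤ 2048 / δ ^ 3 := by positivity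
    have h2 : 0 ≤ 3072 / (γ * δ ^ 2) := by positivity
    linarith
  have hK0 : 0 < K := by
    have : 0 ≤ 2 / γ := by positivity
    linarith
  refine ⟨K, hK0, fun p hp => ?_⟩
  have hub := SimpleGraph.tendsto_unionBound
  have hlower : Tendsto (fun n : ℕ => ENNReal.ofReal (1 -
      (SimpleGraph.unionBound n (2 * Real.log n) + Real.exp (-(σ * n)) +
        Real.exp (-(1 * (n : ℝ)))))) atTop (𝓝 1) := by
    have h := ((hub.add (SimpleGraph.tendsto_exp_neg_mul_natCast hσ)).add
      (SimpleGraph.tendsto_exp_neg_mul_natCast one_pos)).const_sub 1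
    simpa using ENNReal.tendsto_ofReal h
  have hsmall : ∀ᶠ n : ℕ in atTop, Real.exp (-(γ / 6 * n)) +
      SimpleGraph.unionBound n (2 * Real.log n) < 1 := by
    have h := (SimpleGraph.tendsto_exp_neg_mul_natCast (c := γ / 6) (by positivity)).add hub
    rw [add_zero] at h
    exact h.eventually_lt_const one_pos
  refine tendsto_of_tendsto_of_tendsto_of_le_of_le' hlower tendsto_const_nhds ?_
    (Eventually.of_forall fun n => MeasureTheory.prob_le_one)
  filter_upwards [hp, hsmall, eventually_ge_atTop 25] with n hpn hsn hn
  have : Nonempty (Fin n) := ⟨⟨0, by omega⟩⟩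
  have hn' : (25 : ℝ) ≤ n := by exact_mod_cast hn
  have hlog : 1 ≤ Real.log n := by
    rw [Real.le_log_iff_exp_le (by linarith)]
    linarith [Real.exp_one_lt_three]
  rw [div_le_iff₀ (by linarith)] at hpn
  set P : ℝ := (p n : ℝ) with hPdef
  have hP1 : 2048 * Real.log n ≤ δ ^ 3 * (P * n) := by
    have h1 : 2048 / δ ^ 3 * Real.log n ≤ P * n :=
      (mul_le_mul_of_nonneg_right hK1 (by linarith)).trans hpn
    rwa [div_mul_eq_mul_div, div_le_iff₀ (by positivity), mul_comm (P * n)] at h1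
  have hP2 : 3072 * Real.log n ≤ γ * δ ^ 2 * (P * n) := by
    have h1 : 3072 / (γ * δ ^ 2) * Real.log n ≤ P * n :=
      (mul_le_mul_of_nonneg_right hK2 (by linarith)).trans hpn
    rwa [div_mul_eq_mul_div, div_le_iff₀ (by positivity), mul_comm (P * n)] at h1
  have hP3 : 2 / γ + 1 ≤ P * n := by
    have h1 : K * 1 ≤ K * Real.log n := mul_le_mul_of_nonneg_left hlog hK0.le
    linarith
  have hP4 : 1 ≤ P * n := by
    have : 0 ≤ 2 / γ := by positivity
    linarith
  have hP0 : 0 < P := by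
    by_contra! h
    have := mul_nonpos_of_nonpos_of_nonneg h (show (0 : ℝ) ≤ n by linarith)
    linarith
  have hPn2 : (n : ℝ) ≤ P * n ^ 2 := by nlinarith
  have hγn : (n : ℝ) ≤ γ / 2 * (P * n ^ 2) := by
    have h1 : 2 / γ ≤ P * n := by linarith
    rw [div_le_iff₀ hγ] at h1
    nlinarith
  have hmain := SimpleGraph.one_sub_le_binomialRandom_real (V := Fin n) (p n) (ε := δ) (γ := γ)
    (r := 2 * Real.log n) (L := σ⁻¹) hδ hδ1 hP0 hγ.le hγ1 (by linarith) (by positivity)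
    (by simpa using hn) (by simpa using hγn)
    (by rw [Fintype.card_fin]; linarith) (by rw [Fintype.card_fin]; linarith)
    (by
      rw [Fintype.card_fin]
      refine lt_of_le_of_lt (add_le_add_left (Real.exp_le_exp.2 ?_) _) hsn
      have := mul_le_mul_of_nonneg_left hPn2 (show 0 ≤ γ / 6 by positivity)
      linarith)
  rw [Fintype.card_fin] at hmain
  have hbound2 : Real.exp (σ⁻¹ * (γ * (P * (n : ℝ) ^ 2)) + P * Real.exp (-σ⁻¹) * ((n : ℝ) ^ 2 / 2) -
      (δ / 4) ^ 2 * P * ((n : ℝ) ^ 2 / 32) / 4) ≤ Real.exp (-(σ * n)) := by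
    apply Real.exp_le_exp.2
    have h1 : σ⁻¹ * (γ * (P * (n : ℝ) ^ 2)) = σ * (P * n ^ 2) := by
      rw [hγdef]; field_simp
    have h2 : P * Real.exp (-σ⁻¹) * ((n : ℝ) ^ 2 / 2) ≤ P * σ * ((n : ℝ) ^ 2 / 2) := by gcongr
    have h3 : (δ / 4) ^ 2 * P * ((n : ℝ) ^ 2 / 32) / 4 = 4 * σ * (P * n ^ 2) := by
      rw [hσdef]; ring
    have h4 := mul_le_mul_of_nonneg_left hPn2 hσ.le
    have h5 : 0 ≤ σ * (P * n ^ 2) := by positivity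
    rw [h1, h3]
    linarith
  have hbound3 : Real.exp (-(P * (n : ℝ) ^ 2)) ≤ Real.exp (-(1 * (n : ℝ))) :=
    Real.exp_le_exp.2 (by linarith)
  have hd : (1 - ε) * n * P / 6 ≤ (1 - δ) * n * P / 6 := by
    gcongr
  rw [← MeasureTheory.ofReal_measureReal (MeasureTheory.measure_ne_top _ _)]
  refine ENNReal.ofReal_le_ofReal (le_trans ?_ (hmain.trans (MeasureTheory.measureReal_mono
    (fun G hG => ?_) (MeasureTheory.measure_ne_top _ _))))
  · linarith
  · exact ⟨fun H _ _ hH => hG H (hH.trans hd),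
      SimpleGraph.ofReal_le_localResilience fun H _ hH => hG H (hH.trans hd)⟩
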